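/- **Link machines.** A link machine $M$ has finitely many registers and a program, a sequence $i_1,\dots,i_p$ of instructions of the forms $a\gets b+c$; $a\gets 1$; "if $a=b$ (or: if $a\ne b$) execute the next $s$ instructions, otherwise skip them". All registers start at $1$; $g(\ell)$, the *growth*, is the maximum register value after $\ell$ full executions of the program. Assume $g$ is non-decreasing, $g\in\omega(1)$ and $g(\ell)\in 2^{O(\ell)}$. Put $f(\ell)=\ell\,g(\ell)$ and $f^{-1}(y)=\min\{m\in\mathbb N: f(m)\ge y\}$. **Model.** In the deterministic LOCAL model, nodes of a connected $n$-node graph carry unique identifiers from $\{1,\dots,n^c\}$ ($c\ge 1$ a constant) and local inputs, and know $n$; a $t$-round algorithm maps the radius-$t$ neighbourhood of a node to its output. **The problem $\Pi$.** $\Pi$ is an LCL problem on directed cycles (of length at least $3$) with inputs in $\{0,1\}$ and a finite output alphabet $\Gamma$, given by a constraint on the labels in windows of a constant number of consecutive nodes. In a one-sided algorithm with running time $T$, the output of a node depends only on $n$ and on the identifiers and inputs of the node and its $T(n)$ successors. Let $T$ be the complexity of $\Pi$: some one-sided algorithm solves $\Pi$ in time $T$, and $T=O(T')$ whenever some one-sided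 algorithm solves $\Pi$ in time $T'$. **The problem $\Pi_M$.** Inputs: each node $v$ has $i(v)\in\{0,1\}$ and assigns to each incident edge a set of labels from $\mathsf U,\mathsf D,\mathsf L,\mathsf R$ and $(r,i)$, for registers $r$ and $0\le i\le p$. Write $v(L_1,\dots,L_m)$ for the node reached from $v$ by following the edges with these labels; an equation between such nodes includes that they are well defined. The *local constraints* at $v$ are: 1. Each label is on exactly one edge at $v$, except that one of $\mathsf U,\mathsf D$ may be missing; $\mathsf U,\mathsf D,\mathsf L,\mathsf R$ are on different edges. 2. An edge labelled $\mathsf U,\mathsf D,\mathsf L,\mathsf R$ at $v$ has the opposite label at its other end. If $v$ has a $\mathsf D$-edge, then $v(\mathsf D,\mathsf R,\mathsf U)=v(\mathsf R)$. If $v$ has no $\mathsf D$-edge (no $\mathsf U$-edge), then neither have $v(\mathsf L)$ and $v(\mathsf R)$. 3. For all registers $r$: $v((r,0))=v(\mathsf R)$ if $v$ has no $\mathsf D$-edge, and $v((r,0))=v(\mathsf D,(r,p),\mathsf U)$ if it has one. 4. For $i=1,\dots,p$ in order: if instruction $i$ is $a\gets1$, then $v((a,i))=v(\mathsf R)$;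 if it is $a\gets b+c$, then $v((a,i))=v((b,i-1),(c,i-1))$; in both cases $v((r,i))=v((r,i-1))$ for all $r\ne a$. If it is a conditional on $a,b$, then $v((r,i))=v((r,i-1))$ for all $r$, and the test $a=b$ is evaluated as $v((a,i-1))=v((b,i-1))$; if the condition fails, then the next $s$ instructions (or as many as remain) are not checked in this way, but $v((r,j))=v((r,j-1))$ must hold for all $r$ and for each of their indices $j$. 5. If $v$ has no $\mathsf U$-edge, then for some register $r$ the $(r,p)$-edges form a $3$-cycle: $v((r,p),(r,p),(r,p))=v$. Outputs: a label of $\Pi$; the error label $\mathsf E$; an error pointer, which points $\mathsf R$ or $\mathsf U$ and carries a counter in $\mathbb Z/2$ and a label $c_e\in\{0,1\}$; or the empty output. An output is valid if at each node $v$: - $v$ outputs $\mathsf E$ if and only if the local constraints fail at $v$ or at one of its neighbours; - if $v$ outputs a label of $\Pi$, then it has no $\mathsf D$-edge; and the constraint of $\Pi$ holds (with inputs $i(\cdot)$) in every window of consecutive nodes along $\mathsf R$-edges that all output labels of $\Pi$; - if $v$ has empty output, then it has a $\mathsf D$-edge; - if $v$ outputs an error pointer, then it points $\mathsf U$ if $v$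 has a $\mathsf D$-edge; the node $u$ that it points to exists and outputs $\mathsf E$ or an error pointer; if $v$ and $u=v(\mathsf R)$ both point $\mathsf R$, then their counters differ; if $v$ points $\mathsf U$, then $c_e(v)=c_e(u)$ if $u$ outputs a pointer, and $c_e(v)=i(u)$ if $u$ outputs $\mathsf E$. **Theorem.** For $n\ge1$ let $\hat n$ be the smallest natural number with $n\le\hat n\cdot f^{-1}(T(\hat n))$ (assume that it exists for all $n\geq 1$, i.e. $T$ is not eventually $0$). Then for every $\Delta$ the problem $\Pi_M$ can be solved in the LOCAL model in $O\bigl(f^{-1}(T(\hat n))\bigr)$ rounds on all connected $n$-node graphs of maximum degree at most $\Delta$; the constant does not depend on $n$. -/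

import Mathlib

open Filter Asymptotics

noncomputable section

namespace LinkLCL

/-! ## Link machines -/

/-- Instructions on `k` registers. `ifEq a b s` executes the next `s` instructions if `a = b` and
skips them otherwise; `ifNe a b s` executes the next `s` instructions if `a ≠ b` and skips them
otherwise. -/
inductive Instr (k : ℕ) : Type
  | add (a b c : Fin k) : Instr k
  | reset (a : Fin k) : Instr k
  | ifEq (a b : Fin k) (s : ℕ) : Instr k
  | ifNe (a b : Fin k) (s : ℕ) : Instr k

/-- A link machine: finitely many registers and a program. -/
structure LinkMachine where
  numRegs : ℕ
  program : List (Instr numRegs)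

/-- Run a list of instructions on a register assignment. The natural number is the number of
instructions that are still to be skipped. -/
def runProg {k : ℕ} : List (Instr k) → ℕ → (Fin k → ℕ) → (Fin k → ℕ)
  | [], _, σ => σ
  | _ :: P, s + 1, σ => runProg P s σ
  | .add a b c :: P, 0, σ => runProg P 0 (Function.update σ a (σ b + σ c))
  | .reset a :: P, 0, σ => runProg P 0 (Function.update σ a 1)
  | .ifEq a b s :: P, 0, σ => runProg P (if σ a = σ b then 0 else s) σ
  | .ifNe a b s :: P, 0, σ => runProg P (if σ a ≠ σ b then 0 else s) σ

namespace LinkMachine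

/-- The length `p` of the program. -/
def len (M : LinkMachine) : ℕ := M.program.length

/-- `M.regs ℓ r` is the value of register `r` after `ℓ` full executions of the program, starting
from all registers set to `1`. -/
def regs (M : LinkMachine) (ℓ : ℕ) : Fin M.numRegs → ℕ :=
  (runProg M.program 0)^[ℓ] (fun _ => 1)

/-- The growth `g(ℓ)` of a link machine: the maximum register value after `ℓ` executions. -/
def growth (M : LinkMachine) (ℓ : ℕ) : ℕ := Finset.univ.sup (M.regs ℓ)

/-- `f(ℓ) = ℓ g(ℓ)`. -/
def speed (M : LinkMachine) (ℓ : ℕ) : ℕ := ℓ * M.growth ℓ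

end LinkMachine

/-- The generalised inverse `f⁻¹(y) = min {m | f(m) ≥ y}`. -/
def genInv (f : ℕ → ℕ) (y : ℕ) : ℕ := sInf {m | y ≤ f m}

/-! ## LCL problems on directed cycles, and one-sided algorithms -/

/-- An LCL problem on directed cycles with inputs in `{0,1}` and outputs in `Γ`: it is given by the
constraint on the input and output labels in windows of `width + 1` consecutive nodes. The second
argument of `ok` tells which positions of the window are the same node (this happens on cycles that
are shorter than the window only). -/
structure CycleLCL (Γ : Type) where
  width : ℕ
  ok : (Fin (width + 1) → Bool × Γ) → (Fin (width + 1) → Fin (width + 1) → Prop) → Prop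

/-- Valid solutions on the directed cycle with node set `ZMod n` and edges `(v, v + 1)`. -/
def CycleLCL.Valid {Γ : Type} (Q : CycleLCL Γ) (n : ℕ) (x : ZMod n → Bool) (y : ZMod n → Γ) :
    Prop :=
  ∀ v : ZMod n, Q.ok (fun i => (x (v + (i : ℕ)), y (v + (i : ℕ))))
    (fun i j => v + ((i : ℕ) : ZMod n) = v + ((j : ℕ) : ZMod n))

/-- Admissible unique identifiers for `n`-node graphs: distinct elements of `{1, …, n ^ c}`. -/
def IsIdent {V : Type} (n c : ℕ) (ident : V → ℕ) : Prop :=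
  Function.Injective ident ∧ ∀ v, 1 ≤ ident v ∧ ident v ≤ n ^ c

/-- `Q` is solvable on directed cycles by a one-sided algorithm in time `T`: the algorithm knows
`n`, and the output of each node is a function of the identifiers and the inputs of the node itself
and of its `T n` successors. -/
def CycleLCL.OneSidedSolvable {Γ : Type} (Q : CycleLCL Γ) (c : ℕ) (T : ℕ → ℕ) : Prop :=
  ∃ A : (n : ℕ) → (Fin (T n + 1) → ℕ × Bool) → Γ,
    ∀ n : ℕ, 3 ≤ n → ∀ (ident : ZMod n → ℕ) (x : ZMod n → Bool), IsIdent n c ident →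
      Q.Valid n x (fun v => A n (fun j => (ident (v + (j : ℕ)), x (v + (j : ℕ)))))

/-- `T` is the (one-sided) time complexity of `Q`: it is attained by an algorithm, and it is the
slowest-growing function with this property. -/
def CycleLCL.HasComplexity {Γ : Type} (Q : CycleLCL Γ) (c : ℕ) (T : ℕ → ℕ) : Prop :=
  Q.OneSidedSolvable c T ∧
    ∀ T' : ℕ → ℕ, Q.OneSidedSolvable c T' →
      (fun n => (T n : ℝ)) =O[atTop] (fun n => (T' n : ℝ))

/-! ## Labelled graphs and the LOCAL model -/

/-- A graph with an input in `{0,1}` at each node, in which moreover each node assigns a set of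
labels to each of its incident edges. `edgeLabels v u` is the label set that `v` assigns to the edge
between `v` and `u`; it is never used unless `v` and `u` are adjacent. -/
structure LabelledGraph (Lab V : Type) where
  graph : SimpleGraph V
  input : V → Bool
  edgeLabels : V → V → Set Lab

/-- The information contained in a neighbourhood of a node, with nodes named by their
identifiers. -/
structure View (Lab : Type) where
  center : ℕ
  nodes : Set ℕ
  adj : ℕ → ℕ → Prop
  ones : Set ℕ
  edgeLabels : ℕ → ℕ → Set Lab

namespace LabelledGraph

variable {Lab V : Type}

/-- The radius-`t` neighbourhood of `v`: all nodes `u` with `dist(v, u) ≤ t`, all edges between such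
nodes, and the identifiers, inputs and edge labels on them. -/
def view (X : LabelledGraph Lab V) (ident : V → ℕ) (t : ℕ) (v : V) : View Lab where
  center := ident v
  nodes := {a | ∃ u, X.graph.dist v u ≤ t ∧ ident u = a}
  adj := fun a b => ∃ u w, X.graph.dist v u ≤ t ∧ X.graph.dist v w ≤ t ∧ X.graph.Adj u w ∧
    ident u = a ∧ ident w = b
  ones := {a | ∃ u, X.graph.dist v u ≤ t ∧ X.input u = true ∧ ident u = a}
  edgeLabels := fun a b => {l | ∃ u w, X.graph.dist v u ≤ t ∧ X.graph.dist v w ≤ t ∧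
    X.graph.Adj u w ∧ l ∈ X.edgeLabels u w ∧ ident u = a ∧ ident w = b}

/-- The edge between `v` and `u` carries the label `l` at `v`. -/
def Edge (X : LabelledGraph Lab V) (l : Lab) (v u : V) : Prop :=
  X.graph.Adj v u ∧ l ∈ X.edgeLabels v u

/-- The node `v` has an incident edge that it labels with `l`. -/
def Has (X : LabelledGraph Lab V) (l : Lab) (v : V) : Prop := ∃ u, X.Edge l v u

open Classical in
/-- `v(l)`: the other end of the edge labelled with `l` at `v`, if there is exactly one such
edge. -/
def next (X : LabelledGraph Lab V) (l : Lab) (v : V) : Option V :=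
  if h : ∃! u, X.Edge l v u then some h.choose else none

/-- `v(l₁, …, lₘ)`: the node reached from `v` by following the given labels, if it exists. -/
def follow (X : LabelledGraph Lab V) : List Lab → V → Option V
  | [], v => some v
  | l :: ls, v => (X.next l v).bind (X.follow ls)

end LabelledGraph

/-- A graph problem: the set of valid solutions of each finite labelled graph. -/
def GraphProblem (Lab Out : Type) : Type 1 :=
  ∀ V : Type, LabelledGraph Lab V → (V → Out) → Prop

/-- `P` is solvable in the LOCAL model in `R n` rounds on the connected graphs of maximum degree at
most `Δ`, where `n` is the number of nodes: a single deterministic algorithm, which is given `n`,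
maps the radius-`R n` neighbourhood of each node to the output of the node, and the outputs form a
valid solution for all graphs, all inputs and all identifiers from `{1, …, n ^ c}`. -/
def GraphProblem.SolvableInTime {Lab Out : Type} (P : GraphProblem Lab Out) (Δ c : ℕ)
    (R : ℕ → ℕ) : Prop :=
  ∃ A : ℕ → View Lab → Out,
    ∀ (V : Type) [Fintype V] (X : LabelledGraph Lab V) (ident : V → ℕ),
      X.graph.Connected → (∀ v, (X.graph.neighborSet v).ncard ≤ Δ) →
      IsIdent (Fintype.card V) c ident →
      P V X (fun v => A (Fintype.card V) (X.view ident (R (Fintype.card V)) v))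

/-! ## Link machine encoding graphs: labels and local constraints -/

/-- The four grid directions. -/
inductive Dir : Type
  | U | D | L | R

/-- The opposite direction. -/
def Dir.opp : Dir → Dir
  | .U => .D
  | .D => .U
  | .L => .R
  | .R => .L

/-- Edge labels for `k` registers and a program of length `p`: grid directions, and link labels
`(r, i)` with `i = 0, 1, …, p`. -/
inductive ELabel (k p : ℕ) : Type
  | dir (d : Dir) : ELabel k p
  | link (r : Fin k) (i : Fin (p + 1)) : ELabel k p

/-- Edge labels of the link machine `M`. -/
abbrev LinkMachine.Labels (M : LinkMachine) : Type := ELabel M.numRegs M.len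

section Constraints

variable {k p : ℕ} {V : Type}

/-- `v(d)` for a direction `d`. -/
def nextDir (X : LabelledGraph (ELabel k p) V) (d : Dir) (v : V) : Option V := X.next (.dir d) v

/-- `v((r, i))`, for an index `i ≤ p`. -/
def nextLink (X : LabelledGraph (ELabel k p) V) (r : Fin k) (i : ℕ) (v : V) : Option V :=
  if h : i < p + 1 then X.next (.link r ⟨i, h⟩) v else none

/-- Constraint 1: all labels occur exactly once, except that one of `D` and `U` may be missing, and
the direction labels are on different edges. -/
def BasicOK (X : LabelledGraph (ELabel k p) V) (v : V) : Prop :=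
  (∀ r i, ∃! u, X.Edge (.link r i) v u) ∧
  (∃! u, X.Edge (.dir .L) v u) ∧
  (∃! u, X.Edge (.dir .R) v u) ∧
  (X.Has (.dir .U) v → ∃! u, X.Edge (.dir .U) v u) ∧
  (X.Has (.dir .D) v → ∃! u, X.Edge (.dir .D) v u) ∧
  (X.Has (.dir .U) v ∨ X.Has (.dir .D) v) ∧
  ∀ d d' u, X.Edge (.dir d) v u → X.Edge (.dir d') v u → d = d'

/-- Constraint 2: the grid structure. -/
def GridOK (X : LabelledGraph (ELabel k p) V) (v : V) : Prop :=
  (∀ d u, X.Edge (.dir d) v u → X.Edge (.dir d.opp) u v) ∧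
  (X.Has (.dir .D) v → X.follow [.dir .D, .dir .R, .dir .U] v = nextDir X .R v) ∧
  (¬ X.Has (.dir .D) v →
    ∀ u, X.Edge (.dir .L) v u ∨ X.Edge (.dir .R) v u → ¬ X.Has (.dir .D) u) ∧
  (¬ X.Has (.dir .U) v →
    ∀ u, X.Edge (.dir .L) v u ∨ X.Edge (.dir .R) v u → ¬ X.Has (.dir .U) u)

/-- Constraint 3: the registers are initialised to `1` on the bottom row, and copied from the row
below on all other rows. -/
def InitOK (X : LabelledGraph (ELabel k p) V) (v : V) : Prop :=
  (¬ X.Has (.dir .D) v → ∀ r, nextLink X r 0 v = nextDir X .R v) ∧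
  (X.Has (.dir .D) v →
    ∀ r, nextLink X r 0 v = X.follow [.dir .D, .link r (Fin.last p), .dir .U] v)

/-- The link edges of `v` for all registers except those in `S` do not change from index `i` to
index `i + 1`. -/
def Unchanged (X : LabelledGraph (ELabel k p) V) (v : V) (i : ℕ) (S : Set (Fin k)) : Prop :=
  ∀ r, r ∉ S → nextLink X r i v = nextLink X r (i + 1) v

open Classical in
/-- Constraint 4: the link edges of `v` encode the execution of the program. In
`ProgOK X v P i s`, the list `P` consists of the instructions that follow the first `i` ones, of
which the next `s` ones are to be skipped. -/
def ProgOK (X : LabelledGraph (ELabel k p) V) (v : V) : List (Instr k) → ℕ → ℕ → Prop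
  | [], _, _ => True
  | _ :: P, i, s + 1 => Unchanged X v i ∅ ∧ ProgOK X v P (i + 1) s
  | .add a b c :: P, i, 0 =>
      nextLink X a (i + 1) v = (nextLink X b i v).bind (nextLink X c i) ∧
      Unchanged X v i {a} ∧ ProgOK X v P (i + 1) 0
  | .reset a :: P, i, 0 =>
      nextLink X a (i + 1) v = nextDir X .R v ∧
      Unchanged X v i {a} ∧ ProgOK X v P (i + 1) 0
  | .ifEq a b s :: P, i, 0 =>
      Unchanged X v i ∅ ∧
      ProgOK X v P (i + 1) (if nextLink X a i v = nextLink X b i v then 0 else s)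
  | .ifNe a b s :: P, i, 0 =>
      Unchanged X v i ∅ ∧
      ProgOK X v P (i + 1) (if nextLink X a i v ≠ nextLink X b i v then 0 else s)

/-- Constraint 5: on the top row, the final link edges of some register form `3`-cycles. On a cycle
of length `3 g(h)`, these are exactly the registers with the maximum value `g(h)`. -/
def TopOK (X : LabelledGraph (ELabel k p) V) (v : V) : Prop :=
  ¬ X.Has (.dir .U) v → ∃ r : Fin k,
    X.follow [.link r (Fin.last p), .link r (Fin.last p), .link r (Fin.last p)] v = some v

end Constraints

/-- The local constraints of link machine encoding graphs for `M` hold at the node `v`. -/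
def LocalOK (M : LinkMachine) {V : Type} (X : LabelledGraph M.Labels V) (v : V) : Prop :=
  BasicOK X v ∧ GridOK X v ∧ InitOK X v ∧ ProgOK X v M.program 0 0 ∧ TopOK X v

/-! ## The problem `Π_M` -/

/-- Error pointers point right or up. -/
inductive PDir : Type
  | right | up

/-- The direction in which an error pointer leads. -/
def PDir.toDir : PDir → Dir
  | .right => .R
  | .up => .U

/-- Output labels of `Π_M`: the output labels of `Π`, the error label `E`, error pointers with a
counter modulo `2` and a label `c_e` in `{0,1}`, and the empty output. -/
inductive Out (Γ : Type) : Type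
  | sol (y : Γ) : Out Γ
  | err : Out Γ
  | ptr (d : PDir) (counter : ZMod 2) (ce : Bool) : Out Γ
  | empty : Out Γ

/-- The local constraints fail at `v` itself or at one of its neighbours. -/
def NearWitness (M : LinkMachine) {V : Type} (X : LabelledGraph M.Labels V) (v : V) : Prop :=
  ¬ LocalOK M X v ∨ ∃ u, X.graph.Adj v u ∧ ¬ LocalOK M X u

/-- The conditions on an error pointer `(d, q, b)` at the node `v`. -/
def PtrOK {Γ : Type} {k p : ℕ} {V : Type} (X : LabelledGraph (ELabel k p) V) (o : V → Out Γ)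
    (v : V) (d : PDir) (q : ZMod 2) (b : Bool) : Prop :=
  (X.Has (.dir .D) v → d = .up) ∧
  ∃ u, nextDir X d.toDir v = some u ∧
    (o u = .err ∨ ∃ d' q' b', o u = .ptr d' q' b') ∧
    (d = .right → ∀ q' b', o u = .ptr .right q' b' → q ≠ q') ∧
    (d = .up → (∀ d' q' b', o u = .ptr d' q' b' → b = b') ∧ (o u = .err → b = X.input u))

/-- The local constraint of `Q` holds in each window of consecutive nodes (along edges labelled
`R`) that starts at `v` and in which all outputs are labels of `Q`. -/
def WindowOK {Γ : Type} {k p : ℕ} {V : Type} (Q : CycleLCL Γ) (X : LabelledGraph (ELabel k p) V)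
    (o : V → Out Γ) (v : V) : Prop :=
  ∀ (w : Fin (Q.width + 1) → V) (y : Fin (Q.width + 1) → Γ),
    w 0 = v → (∀ i : Fin Q.width, nextDir X .R (w i.castSucc) = some (w i.succ)) →
    (∀ i, o (w i) = .sol (y i)) →
    Q.ok (fun i => (X.input (w i), y i)) (fun i j => w i = w j)

/-- The problem `Π_M`, for a link machine `M` and an LCL problem `Π = Q` on directed cycles. -/
def linkProblem {Γ : Type} (M : LinkMachine) (Q : CycleLCL Γ) :
    GraphProblem M.Labels (Out Γ) := fun _ X o =>
  ∀ v,
    (o v = .err ↔ NearWitness M X v) ∧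
    (∀ y, o v = .sol y → ¬ X.Has (.dir .D) v) ∧
    WindowOK Q X o v ∧
    (o v = .empty → X.Has (.dir .D) v) ∧
    (∀ d q b, o v = .ptr d q b → PtrOK X o v d q b)

end LinkLCL

end

/-!
Each node inspects a part of the grid of height `t = f⁻¹(T(n̂))`. If one of the `t` nodes above a node
has to output `E`, the node points up. A node of the bottom row with no such error above it points
right if one of the next `H = O(T(n̂) + 1)` columns contains an error at height at most `t`; the
distance to the nearest such column, modulo `2`, is its counter. The remaining nodes of the bottom
row solve `Π`, and the other nodes have empty output (`output`, `linkProblem_output`).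

*Running time.* As long as no error occurs, the links at height `i` lead as far as the register
values after `i` executions of the program (`IsRegion.nextLink_zero`). A test `a = b` could only be
evaluated incorrectly if the row wrapped around, or beyond an error; this is excluded by keeping a
distance `margin i` from the next error, where `margin (i + 1) - margin i = 2 ^ p * g i`. To reach
column `j`, climb as high as possible, and then at each height `i` follow links of length `g i` until
the remaining distance is at most `margin i`. This takes a constant number of steps at each height
but the highest one. At height `t` there are `O(H / g t) = O(t)` steps. If the top row is at a height
`h < t`, then the `3`-cycles of the top row show that the row is not wider than
`margin (h + 1) + 2 g (h + 1)`, unless it wraps around, so again a constant number of steps is enough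
(`dist_iterate_rightNode_le`). Hence all nodes that are inspected are within distance `O(t)`, and the
output is determined by the neighbourhood of this radius (`LocalIso.output_eq`, `localIso_view`).

*Solving `Π`.* If the row of a node closes up within sight, all its nodes choose the same solution.
Otherwise there are `H` columns of height at least `t`, so that `H t ≤ n ≤ n̂ t` (`mul_le_card`) and
the visible part of the row fits into a cycle of `n̂` nodes. The algorithm for such cycles can be used
there, but for the identifiers, which are bounded by `n ^ c ≤ n̂ ^ (2 c)` only. This is where `T` has to
be the complexity of `Π`. Either `T n` is at least a constant fraction of `n`, and the visible part is
longer than `n̂`, a contradiction. Or for some length the algorithm does not see half of the cycle, and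
then `T n = O(n ^ (1 / 4))` (`CycleLCL.OneSidedSolvable.gap`): colours from a constant range, distinct
at constant distances, can take the place of identifiers, and one round of Linial's colour reduction
followed by greedy recolouring finds them in this time. In that case one round of Linial's colour
reduction also replaces the identifiers by numbers up to `n̂` that are distinct within the distance
that matters (`CycleLCL.HasComplexity.exists_row_rule`).
-/

noncomputable section

namespace LinkLCL

/-! ### Recolouring identifiers -/

/-- Over `ZMod p` there are at least `N` polynomials of degree at most `d` if `N ≤ p ^ (d + 1)`. -/
theorem exists_injOn_polynomial {p : ℕ} [Fact p.Prime] {d N : ℕ} (hN : N ≤ p ^ (d + 1)) :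
    ∃ P : ℕ → Polynomial (ZMod p), (∀ a, (P a).natDegree ≤ d) ∧ Set.InjOn P (Set.Iio N) := by
  have hc : Fintype.card (Fin N) ≤ Fintype.card (Fin (d + 1) → ZMod p) := by
    simpa [ZMod.card] using hN
  obtain ⟨e⟩ := Function.Embedding.nonempty_of_card_le hc
  let E : Fin N → Polynomial (ZMod p) :=
    fun a => ((Polynomial.degreeLTEquiv (ZMod p) (d + 1)).symm (e a) : Polynomial (ZMod p))
  have hE : Function.Injective E := by
    intro a b hab
    exact e.injective ((Polynomial.degreeLTEquiv (ZMod p) (d + 1)).symm.injective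
      (Subtype.ext hab))
  have hdeg : ∀ a, (E a).natDegree ≤ d := by
    intro a
    have h := Polynomial.mem_degreeLT.1
      ((Polynomial.degreeLTEquiv (ZMod p) (d + 1)).symm (e a)).2
    by_cases h0 : E a = 0
    · simp [h0]
    · exact Nat.lt_succ_iff.1 ((Polynomial.natDegree_lt_iff_degree_lt h0).2 h)
  refine ⟨fun a => if h : a < N then E ⟨a, h⟩ else 0, fun a => ?_, fun a ha b hb hab => ?_⟩
  · dsimp only
    split_ifs
    · exact hdeg _
    · simp
  · simp only [Set.mem_Iio] at ha hb
    simp only [ha, hb, dif_pos] at hab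
    simpa using hE hab

/-- Polynomials of degree at most `d`, all different from `P 0`, agree with `P 0` in few points, so
that `P 0` can be told apart from all of them at a single point. -/
theorem exists_eval_ne {p : ℕ} [Fact p.Prime] {d S : ℕ} (hS : S * d < p)
    (P : ℕ → Polynomial (ZMod p)) (hP : ∀ a, (P a).natDegree ≤ d) :
    ∃ x : ZMod p, ∀ j, 1 ≤ j → j ≤ S → P j ≠ P 0 → (P j).eval x ≠ (P 0).eval x := by
  classical
  let bad : Finset (ZMod p) := (Finset.Icc 1 S).biUnion fun j => (P j - P 0).roots.toFinset
  have hcard : bad.card ≤ S * d := by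
    refine (Finset.card_biUnion_le_card_mul _ _ d fun j _ => ?_).trans (by simp)
    refine (Multiset.toFinset_card_le _).trans ((Polynomial.card_roots' _).trans ?_)
    exact (Polynomial.natDegree_sub_le _ _).trans (max_le (hP j) (hP 0))
  obtain ⟨x, -, hx⟩ : ∃ x ∈ (Finset.univ : Finset (ZMod p)), x ∉ bad :=
    Finset.exists_mem_notMem_of_card_lt_card (by
      rw [Finset.card_univ, ZMod.card]
      exact hcard.trans_lt hS)
  refine ⟨x, fun j h1 h2 hne heq => hx ?_⟩
  simp only [bad, Finset.mem_biUnion, Finset.mem_Icc, Multiset.mem_toFinset]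
  refine ⟨j, ⟨h1, h2⟩, ?_⟩
  rw [Polynomial.mem_roots (sub_ne_zero.2 hne)]
  simp [heq]

/-- One round of Linial's colour reduction on directed paths, for the power graph in which nodes at
distance at most `S` are adjacent: colours below `N` are replaced by colours below `p ^ 2`. -/
theorem exists_linial {p : ℕ} (hp : p.Prime) {S d N : ℕ} (hS : S * d < p)
    (hN : N ≤ p ^ (d + 1)) :
    ∃ col : (ℕ → ℕ) → ℕ, (∀ a, col a < p ^ 2) ∧ DependsOn col (Set.Iic S) ∧
      ∀ a : ℕ → ℕ, ∀ j, 1 ≤ j → j ≤ S → a 0 < N → a j < N → a j ≠ a 0 →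
        col a ≠ col (fun i => a (j + i)) := by
  have : Fact p.Prime := ⟨hp⟩
  obtain ⟨P, hdeg, hinj⟩ := exists_injOn_polynomial hN
  choose pt hpt using fun a : ℕ → ℕ => exists_eval_ne hS (fun i => P (a i)) (fun i => hdeg _)
  let cut : (ℕ → ℕ) → ℕ → ℕ := fun a i => if i ≤ S then a i else 0
  have hcut : ∀ a i, i ≤ S → cut a i = a i := fun a i hi => if_pos hi
  refine ⟨fun a => (pt (cut a)).val * p + ((P (a 0)).eval (pt (cut a))).val, fun a => ?_,
    fun a b hab => ?_, fun a j h1 hj h0 hjN hne heq => ?_⟩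
  · dsimp only
    have h1 := (pt (cut a)).val_lt
    have h2 := ((P (a 0)).eval (pt (cut a))).val_lt
    nlinarith
  · have : cut a = cut b := by
      funext i
      by_cases hi : i ≤ S
      · rw [hcut _ _ hi, hcut _ _ hi, hab i hi]
      · simp [cut, hi]
    dsimp only
    rw [this, hab 0 (by simp)]
  · set b : ℕ → ℕ := fun i => a (j + i) with hb
    have hbz : b 0 = a j := by simp [hb]
    dsimp only at heq
    rw [hbz] at heq
    have hpos := hp.pos
    -- the two digits in base `p` agree
    have hx : (pt (cut a)).val = (pt (cut b)).val := by
      have := congrArg (· / p) heq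
      simpa [Nat.add_div_of_dvd_right, Nat.mul_div_cancel _ hpos,
        Nat.div_eq_of_lt (ZMod.val_lt _)] using this
    have hy : ((P (a 0)).eval (pt (cut a))).val = ((P (a j)).eval (pt (cut b))).val := by
      rw [hx] at heq
      exact Nat.add_left_cancel heq
    have hx' := ZMod.val_injective p hx
    have hy' := ZMod.val_injective p hy
    rw [← hx'] at hy'
    have := hpt (cut a) j h1 hj
    rw [hcut _ _ hj, hcut _ _ (Nat.zero_le _)] at this
    exact this (fun h => hne (hinj hjN h0 h)) hy'.symm

/-- Greedy recolouring of a sequence indexed by `ℤ`: each position takes the least colour that is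
not taken by a position within distance `S` with a smaller original colour. -/
def greedy (S : ℕ) (s : ℤ → ℕ) (i : ℤ) : ℕ :=
  sInf {c | ∀ j : ℤ, |j - i| ≤ S → (h : s j < s i) → greedy S s j ≠ c}
termination_by s i

theorem exists_greedy_le (S : ℕ) (s : ℤ → ℕ) (i : ℤ) :
    ∃ c ≤ 2 * S, ∀ j : ℤ, |j - i| ≤ S → s j < s i → greedy S s j ≠ c := by
  classical
  let bad : Finset ℕ := ((Finset.Icc (i - S) (i + S)).erase i).image (greedy S s)
  have hcard : bad.card ≤ 2 * S := by
    refine Finset.card_image_le.trans ?_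
    rw [Finset.card_erase_of_mem (by simp), Int.card_Icc]
    omega
  obtain ⟨c, hc, hcb⟩ : ∃ c ∈ Finset.range (2 * S + 1), c ∉ bad :=
    Finset.exists_mem_notMem_of_card_lt_card (by rw [Finset.card_range]; omega)
  refine ⟨c, by rw [Finset.mem_range] at hc; omega, fun j hj hlt heq => hcb ?_⟩
  rw [abs_le] at hj
  refine Finset.mem_image.2 ⟨j, Finset.mem_erase.2 ⟨?_, Finset.mem_Icc.2 ⟨?_, ?_⟩⟩, heq⟩
  · rintro rfl
    exact lt_irrefl _ hlt
  · omega
  · omega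

theorem greedy_le (S : ℕ) (s : ℤ → ℕ) (i : ℤ) : greedy S s i ≤ 2 * S := by
  obtain ⟨c, hc, h⟩ := exists_greedy_le S s i
  rw [greedy]
  exact (Nat.sInf_le (Set.mem_ofPred_eq ▸ h)).trans hc

theorem greedy_ne_of_lt {S : ℕ} {s : ℤ → ℕ} {i j : ℤ} (hij : |j - i| ≤ S) (h : s j < s i) :
    greedy S s j ≠ greedy S s i := by
  obtain ⟨c, _, hc⟩ := exists_greedy_le S s i
  have hmem := Nat.sInf_mem (s := {c | ∀ j : ℤ, |j - i| ≤ S → (h : s j < s i) →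
    greedy S s j ≠ c}) ⟨c, hc⟩
  rw [greedy.eq_1 S s i]
  exact hmem j hij h

theorem greedy_ne {S : ℕ} {s : ℤ → ℕ} {i j : ℤ} (hij : |j - i| ≤ S) (h : s i ≠ s j) :
    greedy S s i ≠ greedy S s j := by
  rcases lt_or_gt_of_ne h with h | h
  · exact greedy_ne_of_lt (by rwa [abs_sub_comm]) h
  · exact (greedy_ne_of_lt hij h).symm

/-- The greedy colour of a position is determined by the original colours in a window whose radius
is proportional to the original colour of the position: along each chain of dependencies, the
original colours decrease. -/
theorem greedy_congr {S : ℕ} {s s' : ℤ → ℕ} {i i' : ℤ}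
    (h : ∀ z : ℤ, |z| ≤ (S * s i : ℕ) → s (i + z) = s' (i' + z)) :
    greedy S s i = greedy S s' i' := by
  induction hk : s i using Nat.strong_induction_on generalizing i i' with
  | _ k ih =>
    subst hk
    have h0 : s i = s' i' := by simpa using h 0 (by rw [abs_zero]; positivity)
    have key : ∀ z : ℤ, |z| ≤ S → s (i + z) < s i →
        s (i + z) = s' (i' + z) ∧ greedy S s (i + z) = greedy S s' (i' + z) := by
      intro z hz hlt
      have hS : S + S * s (i + z) ≤ S * s i := by
        calc S + S * s (i + z) = S * (s (i + z) + 1) := by ring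
          _ ≤ S * s i := Nat.mul_le_mul_left _ hlt
      refine ⟨h z ?_, ih _ hlt (fun y hy => ?_) rfl⟩
      · have : (S : ℤ) ≤ (S * s i : ℕ) := by exact_mod_cast (by omega)
        exact hz.trans this
      · have := h (z + y) (by
          refine (abs_add_le _ _).trans ?_
          have : ((S + S * s (i + z) : ℕ) : ℤ) ≤ (S * s i : ℕ) := by exact_mod_cast hS
          rw [Nat.cast_add] at this
          omega)
        simpa [add_assoc] using this
    have hz : ∀ z : ℤ, |z| ≤ S → (s (i + z) < s i ↔ s' (i' + z) < s' i') := by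
      intro z hz
      rcases Nat.eq_zero_or_pos (s i) with h1 | h1
      · rw [← h0, h1]; simp
      · rw [h z ?_, h0]
        have : (S : ℤ) ≤ (S * s i : ℕ) := by exact_mod_cast Nat.le_mul_of_pos_right _ h1
        exact hz.trans this
    rw [greedy.eq_1 S s i, greedy.eq_1 S s' i']
    congr 1
    ext c
    simp only [Set.mem_ofPred_eq]
    constructor
    · intro hc j hj hlt
      have e : i' + (j - i') = j := by ring
      have hlt' := (hz (j - i') hj).2 (by rwa [e])
      have := hc (i + (j - i')) (by simpa using hj) hlt'
      rwa [(key _ hj hlt').2, e] at this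
    · intro hc j hj hlt
      have e : i + (j - i) = j := by ring
      have hlt' : s (i + (j - i)) < s i := by rwa [e]
      have := hc (i' + (j - i)) (by simpa using hj) ((hz _ hj).1 hlt')
      rwa [← (key _ hj hlt').2, e] at this

/-- A one-sided colouring of the power graph with `2 S + 1` colours: one round of colour reduction,
followed by greedy recolouring. The greedy colour of position `K` is used as the colour of position
`0`, since a one-sided algorithm cannot look back. -/
theorem exists_window_colouring {p : ℕ} (hp : p.Prime) {S d N : ℕ} (hS : S * d < p)
    (hN : N ≤ p ^ (d + 1)) :
    ∃ col : (ℕ → ℕ) → ℕ, (∀ a, col a ≤ 2 * S) ∧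
      DependsOn col (Set.Iic (2 * (S * p ^ 2) + S)) ∧
      ∀ a : ℕ → ℕ, (∀ i, a i < N) → (∀ i j, 1 ≤ j → j ≤ S → a (i + j) ≠ a i) →
        ∀ i j, 1 ≤ j → j ≤ S → col (fun l => a (i + l)) ≠ col (fun l => a (i + j + l)) := by
  obtain ⟨col, hlt, hdep, hcol⟩ := exists_linial hp hS hN
  set K := S * p ^ 2 with hK
  have hKle : ∀ a, S * col a ≤ K := fun a => Nat.mul_le_mul_left _ (hlt a).le
  let s : (ℕ → ℕ) → ℤ → ℕ := fun a z => col (fun l => a ((K + z).toNat + l))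
  refine ⟨fun a => greedy S (s a) 0, fun a => greedy_le _ _ _, fun a b hab => ?_,
    fun a haN hne i j h1 hj => ?_⟩
  · refine greedy_congr fun z hz => ?_
    have hz' : |z| ≤ K := hz.trans (by exact_mod_cast hKle _)
    rw [abs_le] at hz'
    refine hdep fun l hl => hab _ ?_
    simp only [Set.mem_Iic] at hl ⊢
    omega
  · have key : greedy S (s fun l => a (i + j + l)) 0 = greedy S (s fun l => a (i + l)) j := by
      refine greedy_congr fun z hz => ?_
      have hz' : |z| ≤ K := hz.trans (by exact_mod_cast hKle _)
      rw [abs_le] at hz'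
      have : i + j + ((K : ℤ) + (0 + z)).toNat = i + ((K : ℤ) + (j + z)).toNat := by omega
      simp only [s, ← add_assoc] at this ⊢
      rw [this]
    dsimp only
    rw [key]
    refine greedy_ne (by simpa using hj) ?_
    have := hcol (fun l => a (i + K + l)) j h1 hj (haN _) (haN _)
      (by simpa [add_assoc] using hne (i + K) j h1 hj)
    have e : ((K : ℤ) + j).toNat = K + j := by omega
    simpa [s, e, add_assoc] using this

/-! ### Rules for rows of nodes -/

section Rows

variable {Γ : Type} {Q : CycleLCL Γ} {c : ℕ} {T : ℕ → ℕ}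

/-- The rule `B`, applied at each position of the sequence `a` of pairs of an identifier and an input
to the part of the sequence that starts there, satisfies the constraint of `Q` in the first
window. -/
def RuleOK (Q : CycleLCL Γ) (B : (ℕ → ℕ × Bool) → Γ) (a : ℕ → ℕ × Bool) : Prop :=
  Q.ok (fun i => ((a i).2, B (fun l => a (i + l)))) (fun i j => (a i).1 = (a j).1)

theorem CycleLCL.ok_congr {p p' : Fin (Q.width + 1) → Bool × Γ}
    {e e' : Fin (Q.width + 1) → Fin (Q.width + 1) → Prop} (h : Q.ok p e) (hp : ∀ i, p' i = p i)
    (he : ∀ i j, e' i j ↔ e i j) : Q.ok p' e' := by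
  rwa [funext hp, funext₂ fun i j => propext (he i j)]

theorem CycleLCL.OneSidedSolvable.exists_valid (hQ : Q.OneSidedSolvable c T) (hc : 1 ≤ c) {w : ℕ}
    (hw : 3 ≤ w) (x : ZMod w → Bool) : ∃ y, Q.Valid w x y := by
  obtain ⟨A, hA⟩ := hQ
  have : NeZero w := ⟨by omega⟩
  refine ⟨_, hA w hw (fun v => v.val + 1) x ⟨fun u v h => ?_, fun v => ⟨Nat.le_add_left 1 _, ?_⟩⟩⟩
  · exact ZMod.val_injective w (Nat.add_right_cancel h)
  · exact (Nat.succ_le_of_lt v.val_lt).trans (Nat.le_self_pow (Nat.one_le_iff_ne_zero.1 hc) w)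

/-- A cycle of `w` nodes that is visible in full: all nodes agree on a solution, reading the cycle
from the node with the least identifier on. -/
theorem CycleLCL.OneSidedSolvable.exists_cyclic_rule (hQ : Q.OneSidedSolvable c T) (hc : 1 ≤ c)
    {w : ℕ} (hw : 3 ≤ w) :
    ∃ B : (ℕ → ℕ × Bool) → Γ, DependsOn B (Set.Iio w) ∧
      ∀ a, Function.Periodic a w → Set.InjOn (fun i => (a i).1) (Set.Iio w) → RuleOK Q B a := by
  have : NeZero w := ⟨by omega⟩
  choose Y hY using fun x : ZMod w → Bool => hQ.exists_valid hc hw x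
  have hmin : ∀ a : ℕ → ℕ × Bool, ∃ k < w, ∀ i < w, (a k).1 ≤ (a i).1 := by
    intro a
    obtain ⟨k, hk, hmin⟩ := Finset.exists_min_image (Finset.range w) (fun i => (a i).1)
      ⟨0, by simp; omega⟩
    exact ⟨k, Finset.mem_range.1 hk, fun i hi => hmin i (Finset.mem_range.2 hi)⟩
  choose k hkw hk using hmin
  let F : (ℕ → ℕ × Bool) → Γ := fun a => Y (fun z => (a (k a + z.val)).2) (-(k a : ZMod w))
  refine ⟨fun a => F (fun i => a (i % w)), fun a b hab => ?_, fun a ha hinj => ?_⟩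
  · have : (fun i => a (i % w)) = fun i => b (i % w) :=
      funext fun i => hab _ (Nat.mod_lt _ (by omega))
    dsimp only
    rw [this]
  · have hper : ∀ i, (fun l => a (i + l % w)) = fun l => a (i + l) := by
      intro i
      funext l
      rw [← ha.map_mod_nat (i + l % w), Nat.add_mod_mod, ha.map_mod_nat]
    have hcast : ∀ i j : ℕ, (i : ZMod w) = j → a i = a j := by
      intro i j hij
      rw [← ha.map_mod_nat i, (ZMod.natCast_eq_natCast_iff' i j w).1 hij, ha.map_mod_nat]
    have hid : ∀ i j : ℕ, (a i).1 = (a j).1 ↔ (i : ZMod w) = j := by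
      refine fun i j => ⟨fun h => ?_, fun h => by rw [hcast i j h]⟩
      rw [ZMod.natCast_eq_natCast_iff']
      refine hinj (Nat.mod_lt _ (by omega)) (Nat.mod_lt _ (by omega)) ?_
      dsimp only
      rwa [ha.map_mod_nat, ha.map_mod_nat]
    -- all positions find the same base point
    have hbase : ∀ i, ((i + k (fun l => a (i + l)) : ℕ) : ZMod w) = k a := by
      intro i
      rw [← hid]
      apply le_antisymm
      · have h1 := hk (fun l => a (i + l)) (((k a : ZMod w) - i).val) (ZMod.val_lt _)
        have e : a (i + ((k a : ZMod w) - i).val) = a (k a) := hcast _ _ (by simp)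
        rwa [e] at h1
      · have h1 := hk a ((i + k (fun l => a (i + l))) % w) (Nat.mod_lt _ (by omega))
        rwa [ha.map_mod_nat] at h1
    have hF : ∀ i : ℕ, F (fun l => a (i + l)) =
        Y (fun z => (a (k a + z.val)).2) (-(k a : ZMod w) + i) := by
      intro i
      have hb := hbase i
      push_cast at hb
      have e1 : (fun z : ZMod w => (a (i + (k (fun l => a (i + l)) + z.val))).2) =
          fun z : ZMod w => (a (k a + z.val)).2 := by
        funext z
        rw [hcast (i + (k (fun l => a (i + l)) + z.val)) (k a + z.val)]
        push_cast
        rw [← add_assoc, hb]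
      have e2 : -(k (fun l => a (i + l)) : ZMod w) = -(k a : ZMod w) + i := by
        rw [← hb]; ring
      simp only [F]
      rw [e1, e2]
    have hv := hY (fun z => (a (k a + z.val)).2) (-(k a : ZMod w))
    refine CycleLCL.ok_congr hv (fun i => ?_) fun i j => ?_
    · dsimp only
      rw [hper, hF]
      refine Prod.ext ?_ rfl
      dsimp only
      rw [hcast i (k a + (-(k a : ZMod w) + (i : ℕ)).val)]
      simp
    · simp [hid]

/-- An algorithm for cycles of `m` nodes works on all sequences of sufficiently many distinct
identifiers below `m`: such a sequence extends to a cycle. -/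
theorem CycleLCL.ok_of_injOn {t m : ℕ} {A : (Fin (t + 1) → ℕ × Bool) → Γ} (hm : 3 ≤ m)
    (hA : ∀ (ident : ZMod m → ℕ) (x : ZMod m → Bool), IsIdent m c ident →
      Q.Valid m x (fun v => A (fun j => (ident (v + (j : ℕ)), x (v + (j : ℕ))))))
    (hc : 1 ≤ c) (hm' : t + Q.width + 1 ≤ m) (b : ℕ → ℕ × Bool)
    (hinj : Set.InjOn (fun i => (b i).1) (Set.Iic (t + Q.width)))
    (hr : ∀ i ≤ t + Q.width, 1 ≤ (b i).1 ∧ (b i).1 ≤ m) :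
    Q.ok (fun i => ((b i).2, A (fun j => b (i + j)))) (fun i j => i = j) := by
  classical
  have : NeZero m := ⟨by omega⟩
  obtain ⟨g, hg⟩ := Set.MapsTo.exists_equiv_extend_of_card_eq (α := ZMod m)
    (t := Finset.Icc 1 m) (s := {v | v.val ≤ t + Q.width}) (f := fun v => (b v.val).1)
    (by simp [ZMod.card]) (fun v hv => by simpa using hr _ hv)
    (fun u hu v hv h => ZMod.val_injective m (hinj hu hv h))
  have hident : IsIdent m c (fun v => (g v : ℕ)) := by
    refine ⟨fun u v h => g.injective (Subtype.ext h), fun v => ?_⟩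
    have := Finset.mem_Icc.1 (g v).2
    exact ⟨this.1, this.2.trans (Nat.le_self_pow (Nat.one_le_iff_ne_zero.1 hc) m)⟩
  have hval : ∀ i : ℕ, i ≤ t + Q.width → ((i : ℕ) : ZMod m).val = i :=
    fun i hi => ZMod.val_cast_of_lt (by omega)
  have hv := hA (fun v => g v) (fun v => (b v.val).2) hident 0
  refine CycleLCL.ok_congr hv (fun i => ?_) fun i j => ?_
  · have hi := i.2
    refine Prod.ext ?_ (congrArg A (funext fun j => ?_))
    · simp only [zero_add]
      rw [hval i (by omega)]
    · have hj := j.2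
      have e : (0 + ((i : ℕ) : ZMod m) + ((j : ℕ) : ZMod m)) = ((i + j : ℕ) : ZMod m) := by
        push_cast; ring
      have hle : (i : ℕ) + j ≤ t + Q.width := by omega
      have hmem : ((i + j : ℕ) : ZMod m) ∈ {v : ZMod m | v.val ≤ t + Q.width} := by
        simpa only [Set.mem_ofPred_eq, hval _ hle] using hle
      rw [e, hg _ hmem, hval _ hle]
  · have hi := i.2
    have hj := j.2
    rw [zero_add, zero_add, Fin.ext_iff]
    refine ⟨fun h => by rw [h], fun h => ?_⟩
    rw [← hval i (by omega), h, hval j (by omega)]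

/-- A rule for periodic sequences is a one-sided algorithm. -/
theorem CycleLCL.oneSidedSolvable_of_rules
    (h : ∀ n, 3 ≤ n → ∃ B : (ℕ → ℕ × Bool) → Γ, DependsOn B (Set.Iic (T n)) ∧
      ∀ a, Function.Periodic a n → Set.InjOn (fun i => (a i).1) (Set.Iio n) →
        (∀ i, (a i).1 ≤ n ^ c) → RuleOK Q B a) :
    Q.OneSidedSolvable c T := by
  have : Nonempty Γ := ⟨(h 3 le_rfl).choose fun _ => (0, false)⟩
  choose! B hdep hB using h
  refine ⟨fun n win => B n (fun j => if hj : j < T n + 1 then win ⟨j, hj⟩ else (0, false)),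
    fun n hn ident x hid v => ?_⟩
  have : NeZero n := ⟨by omega⟩
  let a : ℕ → ℕ × Bool := fun j => (ident (v + (j : ℕ)), x (v + (j : ℕ)))
  have hper : Function.Periodic a n := by
    intro j
    simp [a]
  have hinj : Set.InjOn (fun i => (a i).1) (Set.Iio n) := by
    intro i hi j hj hij
    have h1 : ((i : ℕ) : ZMod n) = ((j : ℕ) : ZMod n) := add_left_cancel (hid.1 hij)
    rw [ZMod.natCast_eq_natCast_iff'] at h1
    rwa [Nat.mod_eq_of_lt hi, Nat.mod_eq_of_lt hj] at h1
  refine CycleLCL.ok_congr (hB n hn a hper hinj fun i => (hid.2 _).2) (fun i => ?_) fun i j => ?_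
  · refine Prod.ext rfl (hdep n hn fun j hj => ?_)
    have hj' : j < T n + 1 := Nat.lt_succ_of_le hj
    simp [a, hj', Nat.cast_add, add_assoc]
  · simp [a, hid.1.eq_iff]

/-- Periodic sequences with injective periods have no repetition at distances below the period. -/
theorem periodic_ne {a : ℕ → ℕ × Bool} {w : ℕ} (ha : Function.Periodic a w)
    (hinj : Set.InjOn (fun i => (a i).1) (Set.Iio w)) (i j : ℕ) (h1 : 1 ≤ j) (hj : j < w) :
    (a (i + j)).1 ≠ (a i).1 := by
  intro h
  have hw : 0 < w := by omega
  have h2 : (i + j) % w = i % w := by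
    refine hinj (Nat.mod_lt _ hw) (Nat.mod_lt _ hw) ?_
    dsimp only
    rwa [ha.map_mod_nat, ha.map_mod_nat]
  have h3 : j ≡ 0 [MOD w] := Nat.ModEq.add_left_cancel' i h2
  have := Nat.le_of_dvd h1 ((Nat.modEq_zero_iff_dvd).1 h3)
  omega

/-- A gap theorem: if on cycles of some length the algorithm does not see half of the cycle, then `Q`
is solvable in time `O(n ^ (1 / 4))`. Locally distinct identifiers from a constant range suffice to
run the given algorithm for that length, and they can be computed fast. -/
theorem CycleLCL.OneSidedSolvable.gap (hQ : Q.OneSidedSolvable c T) (hc : 1 ≤ c) {m : ℕ}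
    (hm : 3 ≤ m) (hT : 2 * (T m + Q.width) + 1 ≤ m) :
    ∃ C, Q.OneSidedSolvable c (fun n => C * (Nat.sqrt (Nat.sqrt n) + 1)) := by
  obtain ⟨A, hA⟩ := id hQ
  set S := T m + Q.width with hS
  set R := S * (8 * c) + 1 with hR
  refine ⟨R ^ 8 + 9 * S + T m, CycleLCL.oneSidedSolvable_of_rules fun n hn => ?_⟩
  set q := Nat.sqrt (Nat.sqrt n) with hq
  set r := Nat.sqrt q with hr
  have hr1 : n < (r + 1) ^ 8 := by
    have h1 : n < (Nat.sqrt n + 1) ^ 2 := Nat.lt_succ_sqrt' n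
    have h2 : Nat.sqrt n < (q + 1) ^ 2 := Nat.lt_succ_sqrt' _
    have h3 : q < (r + 1) ^ 2 := Nat.lt_succ_sqrt' _
    calc n < (Nat.sqrt n + 1) ^ 2 := h1
      _ ≤ ((q + 1) ^ 2) ^ 2 := Nat.pow_le_pow_left h2 2
      _ ≤ (((r + 1) ^ 2) ^ 2) ^ 2 := Nat.pow_le_pow_left (Nat.pow_le_pow_left h3 2) 2
      _ = (r + 1) ^ 8 := by ring
  have hrq : r ^ 2 ≤ q := Nat.sqrt_le' q
  have hqn : q ≤ n := (Nat.sqrt_le_self _).trans (Nat.sqrt_le_self _)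
  have hrn : r ≤ n := (Nat.sqrt_le_self _).trans hqn
  by_cases hcase : r < R
  · -- short cycles are visible in full
    obtain ⟨B, hdep, hB⟩ := hQ.exists_cyclic_rule hc hn
    refine ⟨B, hdep.mono fun i hi => ?_, fun a ha hinj _ => hB a ha hinj⟩
    simp only [Set.mem_Iio, Set.mem_Iic] at hi ⊢
    have : (r + 1) ^ 8 ≤ R ^ 8 := Nat.pow_le_pow_left hcase 8
    nlinarith [Nat.zero_le ((R ^ 8 + 9 * S + T m) * q)]
  · obtain ⟨p, hp, hrp, hp2⟩ := Nat.exists_prime_lt_and_le_two_mul r (by omega)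
    have hSd : S * (8 * c - 1) < p := by
      have : S * (8 * c - 1) ≤ S * (8 * c) := Nat.mul_le_mul_left _ (Nat.sub_le _ _)
      omega
    have hN : n ^ c + 1 ≤ p ^ (8 * c - 1 + 1) := by
      rw [Nat.sub_add_cancel (by omega), pow_mul]
      exact Nat.pow_lt_pow_left (hr1.trans_le (Nat.pow_le_pow_left hrp 8)) (by omega)
    obtain ⟨col, hle, hdep, hcol⟩ := exists_window_colouring hp hSd hN
    refine ⟨fun a => A m (fun j => (col (fun l => (a (j + l)).1) + 1, (a j).2)),
      fun a b hab => ?_, fun a ha hinj hran => ?_⟩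
    · have hp4 : S * p ^ 2 ≤ S * (4 * q) := by
        refine Nat.mul_le_mul_left _ ?_
        calc p ^ 2 ≤ (2 * r) ^ 2 := Nat.pow_le_pow_left hp2 2
          _ = 4 * r ^ 2 := by ring
          _ ≤ 4 * q := by omega
      have hbound : T m + (2 * (S * p ^ 2) + S) ≤ (R ^ 8 + 9 * S + T m) * (q + 1) := by
        nlinarith [Nat.zero_le (R ^ 8 * (q + 1)), Nat.zero_le (S * q), Nat.zero_le (T m * q)]
      refine congrArg (A m) (funext fun j => ?_)
      have hj := j.2
      have e1 : col (fun l => (a (j + l)).1) = col (fun l => (b (j + l)).1) := by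
        refine hdep fun l hl => ?_
        rw [hab]
        simp only [Set.mem_Iic] at hl ⊢
        omega
      rw [e1, hab j]
      simp only [Set.mem_Iic]
      omega
    · have hSn : S < n := by
        have : S ≤ S * (8 * c) := Nat.le_mul_of_pos_right _ (by omega)
        omega
      have hne : ∀ i j, 1 ≤ j → j ≤ S → (a (i + j)).1 ≠ (a i).1 :=
        fun i j h1 hj => periodic_ne ha hinj i j h1 (by omega)
      have hcol' := hcol (fun i => (a i).1) (fun i => Nat.lt_succ_of_le (hran i)) hne
      have := CycleLCL.ok_of_injOn (Q := Q) hm (hA m hm) hc (by omega)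
        (fun j => (col (fun l => (a (j + l)).1) + 1, (a j).2)) ?_ ?_
      · refine CycleLCL.ok_congr this (fun i => ?_) fun i j => ?_
        · simp [add_assoc]
        · have hi := i.2
          have hj := j.2
          refine ⟨fun h => ?_, fun h => by rw [h]⟩
          refine Fin.ext (hinj (Set.mem_Iio.2 ?_) (Set.mem_Iio.2 ?_) h) <;> omega
      · have aux : ∀ i j, i < j → j ≤ S →
            col (fun l => (a (i + l)).1) + 1 ≠ col (fun l => (a (j + l)).1) + 1 := by
          intro i j hij hj h
          refine hcol' i (j - i) (by omega) (by omega) ?_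
          rw [Nat.add_sub_cancel' hij.le]
          exact Nat.add_right_cancel h
        intro i hi j hj h
        rcases lt_trichotomy i j with hlt | rfl | hlt
        · exact absurd h (aux i j hlt hj)
        · rfl
        · exact absurd h.symm (aux j i hlt hi)
      · intro i _
        have := hle (fun l => (a (i + l)).1)
        exact ⟨by omega, by omega⟩

/-- If `Q` has complexity `T`, then for each `m`, either the algorithm for `m` nodes sees a constant
fraction of the cycle (as it does on all short cycles), or `T m` is far below `Nat.sqrt m`. -/
theorem CycleLCL.HasComplexity.dichotomy (hQ : Q.HasComplexity c T) (hc : 1 ≤ c) (D : ℕ) :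
    ∃ K, ∀ m, m ≤ K * (T m + 1) ∨ D * (T m + 1) < Nat.sqrt m := by
  by_cases hcase : ∃ m, 3 ≤ m ∧ 2 * (T m + Q.width) + 1 ≤ m
  · obtain ⟨m0, hm0, hT0⟩ := hcase
    obtain ⟨C, hC⟩ := hQ.1.gap hc hm0 hT0
    obtain ⟨C', hC'⟩ := (hQ.2 _ hC).bound
    obtain ⟨N, hN⟩ := eventually_atTop.1 hC'
    obtain ⟨E, hE⟩ := exists_nat_ge (C' * C)
    have hTm : ∀ m, N ≤ m → T m ≤ E * (Nat.sqrt (Nat.sqrt m) + 1) := by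
      intro m hm
      have h1 := hN m hm
      rw [Real.norm_of_nonneg (by positivity), Real.norm_of_nonneg (by positivity)] at h1
      have h2 : (T m : ℝ) ≤ (E * (Nat.sqrt (Nat.sqrt m) + 1) : ℕ) := by
        refine h1.trans ?_
        push_cast
        rw [← mul_assoc]
        gcongr
      exact_mod_cast h2
    refine ⟨N + (D * (2 * E + 1) + 1) ^ 4 + 1, fun m => ?_⟩
    by_cases hm : m ≤ N + (D * (2 * E + 1) + 1) ^ 4
    · left
      nlinarith [Nat.zero_le (T m)]
    · right
      push Not at hm
      have hle := hTm m (by omega)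
      set s := Nat.sqrt (Nat.sqrt m) with hs
      have hs1 : D * (2 * E + 1) + 1 ≤ s := by
        rw [hs, Nat.le_sqrt', Nat.le_sqrt', ← pow_mul]
        exact (Nat.le_add_left _ _).trans hm.le
      have hs2 : E * 1 ≤ E * s := Nat.mul_le_mul_left _ (by omega)
      calc D * (T m + 1) ≤ D * ((2 * E + 1) * s) := by
            refine Nat.mul_le_mul_left _ ?_
            nlinarith
        _ = D * (2 * E + 1) * s := by ring
        _ < s * s := Nat.mul_lt_mul_of_pos_right (by omega) (by omega)
        _ ≤ Nat.sqrt m := Nat.sqrt_le _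
  · refine ⟨2 * Q.width + 3, fun m => Or.inl ?_⟩
    by_cases hm : 3 ≤ m
    · have : ¬ 2 * (T m + Q.width) + 1 ≤ m := fun h => hcase ⟨m, hm, h⟩
      nlinarith [Nat.zero_le (Q.width * T m)]
    · nlinarith [Nat.zero_le (Q.width * T m)]

/-- The rule by which the nodes of a row choose their labels: it reads `H + 1` consecutive nodes, for
any `H` above a constant multiple of `T m + 1`. It works if the row closes up within this
distance, and also if it does not, provided that `H < m`; in the latter case, identifiers up to
`m ^ (2 c)` are allowed, since they are recoloured by numbers up to `m`. -/
theorem CycleLCL.HasComplexity.exists_row_rule (hQ : Q.HasComplexity c T) (hc : 1 ≤ c) :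
    ∃ K, ∀ m H, K * (T m + 1) ≤ H → ∃ B : (ℕ → ℕ × Bool) → Γ, DependsOn B (Set.Iic H) ∧
      (∀ a w, 3 ≤ w → w ≤ H → Function.Periodic a w →
        Set.InjOn (fun i => (a i).1) (Set.Iio w) → RuleOK Q B a) ∧
      (∀ a : ℕ → ℕ × Bool, H < m → (∀ i ≤ H, (a i).1 ≤ m ^ (2 * c)) →
        (∀ i w, 1 ≤ w → w ≤ H → i + w ≤ H + Q.width → (a (i + w)).1 ≠ (a i).1) →
        RuleOK Q B a) := by
  classical
  obtain ⟨K, hK⟩ := hQ.dichotomy hc (2 * ((Q.width + 1) * (6 * c)) + 8)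
  obtain ⟨A, hA⟩ := hQ.1
  refine ⟨K + 3 * (Q.width + 1), fun m H hH => ?_⟩
  have hKH : K * (T m + 1) ≤ H := le_trans (by gcongr; omega) hH
  have hSH : 3 * (T m + Q.width) + 3 ≤ H := by
    nlinarith [Nat.zero_le (K * (T m + 1)), Nat.zero_le (Q.width * T m)]
  set S := T m + Q.width with hS
  -- the rule for rows that do not close up
  obtain ⟨B₀, hB₀dep, hB₀⟩ : ∃ B : (ℕ → ℕ × Bool) → Γ, DependsOn B (Set.Iic H) ∧
      (∀ a : ℕ → ℕ × Bool, H < m → (∀ i ≤ H, (a i).1 ≤ m ^ (2 * c)) →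
        (∀ i w, 1 ≤ w → w ≤ H → i + w ≤ H + Q.width → (a (i + w)).1 ≠ (a i).1) →
        RuleOK Q B a) := by
    by_cases hm : m ≤ H
    · exact ⟨fun _ => A m (fun _ => (0, false)), fun _ _ _ => rfl,
        fun a h => absurd h (by omega)⟩
    have hD : (2 * ((Q.width + 1) * (6 * c)) + 8) * (T m + 1) < Nat.sqrt m :=
      (hK m).resolve_left (by omega)
    have hs : 2 * (S * (6 * c)) + 8 < Nat.sqrt m := by
      refine lt_of_le_of_lt ?_ hD
      have : S ≤ (Q.width + 1) * (T m + 1) := by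
        rw [hS]; nlinarith [Nat.zero_le (Q.width * T m)]
      calc 2 * (S * (6 * c)) + 8 ≤ 2 * ((Q.width + 1) * (T m + 1) * (6 * c)) + 8 * (T m + 1) := by
            gcongr
            omega
        _ = _ := by ring
    obtain ⟨p, hp, hp1, hp2⟩ := Nat.exists_prime_lt_and_le_two_mul (Nat.sqrt m / 2) (by omega)
    have hpm : p ^ 2 ≤ m :=
      (Nat.pow_le_pow_left (by omega : p ≤ Nat.sqrt m) 2).trans (Nat.sqrt_le' m)
    have hmp : m < p ^ 3 := by
      have h1 : m < (Nat.sqrt m + 1) ^ 2 := Nat.lt_succ_sqrt' m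
      calc m < (Nat.sqrt m + 1) ^ 2 := h1
        _ ≤ (2 * p) ^ 2 := Nat.pow_le_pow_left (by omega) 2
        _ = 4 * p ^ 2 := by ring
        _ ≤ p * p ^ 2 := Nat.mul_le_mul_right _ (by omega)
        _ = p ^ 3 := by ring
    have hSd : S * (6 * c - 1) < p := by
      have : S * (6 * c - 1) ≤ S * (6 * c) := Nat.mul_le_mul_left _ (Nat.sub_le _ _)
      omega
    have hN : m ^ (2 * c) + 1 ≤ p ^ (6 * c - 1 + 1) := by
      rw [Nat.sub_add_cancel (by omega), show 6 * c = 3 * (2 * c) by ring, pow_mul p]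
      exact Nat.pow_lt_pow_left hmp (show 2 * c ≠ 0 by omega)
    obtain ⟨col, hlt, hdep, hcol⟩ := exists_linial hp hSd hN
    refine ⟨fun a => A m (fun j => (col (fun l => (a (j + l)).1) + 1, (a j).2)),
      fun a b hab => ?_, fun a _ hran hne => ?_⟩
    · refine congrArg (A m) (funext fun j => ?_)
      have hj := j.2
      have e1 : col (fun l => (a (j + l)).1) = col (fun l => (b (j + l)).1) := by
        refine hdep fun l hl => ?_
        rw [hab]
        simp only [Set.mem_Iic] at hl ⊢
        omega
      rw [e1, hab j]
      simp only [Set.mem_Iic]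
      omega
    · have := CycleLCL.ok_of_injOn (Q := Q) (by omega) (hA m (by omega)) hc (by omega)
        (fun j => (col (fun l => (a (j + l)).1) + 1, (a j).2)) ?_ ?_
      · refine CycleLCL.ok_congr this (fun i => ?_) fun i j => ?_
        · simp [add_assoc]
        · have hi := i.2
          have hj := j.2
          refine ⟨fun h => ?_, fun h => by rw [h]⟩
          rcases lt_trichotomy (i : ℕ) j with hlt | heq | hlt
          · refine absurd h.symm ?_
            have := hne i (j - i) (by omega) (by omega) (by omega)
            rwa [Nat.add_sub_cancel' hlt.le] at this
          · exact Fin.ext heq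
          · refine absurd h ?_
            have := hne j (i - j) (by omega) (by omega) (by omega)
            rwa [Nat.add_sub_cancel' hlt.le] at this
      · have aux : ∀ i j, i < j → j ≤ S →
            col (fun l => (a (i + l)).1) + 1 ≠ col (fun l => (a (j + l)).1) + 1 := by
          intro i j hij hj h
          have h1 := hcol (fun l => (a (i + l)).1) (j - i) (by omega) (by omega)
            (Nat.lt_succ_of_le (hran _ (by omega))) (Nat.lt_succ_of_le (hran _ (by omega)))
            (hne i (j - i) (by omega) (by omega) (by omega))
          simp only [← add_assoc, Nat.add_sub_cancel' hij.le] at h1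
          exact h1 (Nat.add_right_cancel h)
        intro i hi j hj h
        rcases lt_trichotomy i j with hlt | rfl | hlt
        · exact absurd h (aux i j hlt hj)
        · rfl
        · exact absurd h.symm (aux j i hlt hi)
      · intro i _
        have := hlt (fun l => (a (i + l)).1)
        exact ⟨by omega, by omega⟩
  -- the rules for rows that close up after `w` steps
  have : Nonempty Γ := ⟨B₀ fun _ => (0, false)⟩
  choose! Bc hBcdep hBc using fun w (hw : 3 ≤ w) => hQ.1.exists_cyclic_rule hc hw
  obtain ⟨wraps, hwraps⟩ : ∃ P : (ℕ → ℕ × Bool) → ℕ → Prop, ∀ a w,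
      P a w ↔ 3 ≤ w ∧ w ≤ H ∧ (a w).1 = (a 0).1 := ⟨_, fun _ _ => Iff.rfl⟩
  let rule : (ℕ → Prop) → (ℕ → ℕ × Bool) → Γ := fun P a =>
    if h : ∃ w, P w then Bc (Nat.find h) a else B₀ a
  refine ⟨fun a => rule (wraps a) a, fun a b hab => ?_, fun a w hw hwH ha hinj => ?_,
    fun a hHm hran hne => ?_⟩
  · have hwr : wraps a = wraps b := by
      funext w
      simp only [hwraps, eq_iff_iff]
      refine and_congr_right fun _ => and_congr_right fun hw => ?_
      rw [hab w hw, hab 0 (by simp)]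
    dsimp only
    rw [hwr]
    dsimp only [rule]
    split_ifs with h
    · obtain ⟨h1, h2, -⟩ := (hwraps _ _).1 (Nat.find_spec h)
      exact hBcdep _ h1 fun i hi => hab i ((le_of_lt hi).trans h2)
    · exact hB₀dep hab
  · have key : ∀ i : ℕ, rule (wraps fun l => a (i + l)) (fun l => a (i + l)) =
        Bc w (fun l => a (i + l)) := by
      intro i
      have hw' : wraps (fun l => a (i + l)) w :=
        (hwraps _ _).2 ⟨hw, hwH, by simp [ha i]⟩
      have hex : ∃ w, wraps (fun l => a (i + l)) w := ⟨w, hw'⟩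
      have hfind : Nat.find hex = w := by
        refine (Nat.find_eq_iff hex).2 ⟨hw', fun w' hlt h => ?_⟩
        rw [hwraps] at h
        exact periodic_ne ha hinj i w' (by have := h.1; omega) hlt h.2.2
      dsimp only [rule]
      rw [dif_pos hex, hfind]
    exact CycleLCL.ok_congr (hBc w hw a ha hinj) (fun i => Prod.ext rfl (key i)) fun i j => Iff.rfl
  · refine CycleLCL.ok_congr (hB₀ a hHm hran hne) (fun i => Prod.ext rfl ?_) fun i j => Iff.rfl
    dsimp only [rule]
    rw [dif_neg]
    rintro ⟨w, hw⟩
    obtain ⟨hw3, hwH, hw⟩ := (hwraps _ _).1 hw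
    exact hne i w (by omega) hwH (by have := i.2; omega) hw

end Rows

/-! ### Register values -/

theorem runProg_pos {k : ℕ} (P : List (Instr k)) (s : ℕ) (σ : Fin k → ℕ) (h : ∀ r, 1 ≤ σ r) :
    ∀ r, 1 ≤ runProg P s σ r := by
  induction P generalizing s σ with
  | nil => simpa [runProg] using h
  | cons I P ih =>
    cases s with
    | succ s => simpa [runProg] using ih s σ h
    | zero =>
      cases I with
      | add a b c =>
        simp only [runProg]
        refine ih 0 _ fun r => ?_
        rw [Function.update_apply]
        split_ifs
        · exact (h b).trans (Nat.le_add_right _ _)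
        · exact h r
      | reset a =>
        simp only [runProg]
        refine ih 0 _ fun r => ?_
        rw [Function.update_apply]
        split_ifs
        · exact le_rfl
        · exact h r
      | ifEq a b s => simpa only [runProg] using ih _ σ h
      | ifNe a b s => simpa only [runProg] using ih _ σ h

theorem runProg_le {k : ℕ} (P : List (Instr k)) (s : ℕ) (σ : Fin k → ℕ) (G : ℕ) (hG : 1 ≤ G)
    (h : ∀ r, σ r ≤ G) : ∀ r, runProg P s σ r ≤ 2 ^ P.length * G := by
  have key : ∀ G n : ℕ, 2 ^ n * (2 * G) = 2 ^ (n + 1) * G := fun G n => by ring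
  have hle : ∀ G n : ℕ, 2 ^ n * G ≤ 2 ^ (n + 1) * G := fun G n =>
    Nat.mul_le_mul_right _ (Nat.pow_le_pow_right (by omega) (by omega))
  induction P generalizing s σ G with
  | nil => simpa [runProg] using h
  | cons I P ih =>
    rw [List.length_cons]
    cases s with
    | succ s =>
      intro r
      simp only [runProg]
      exact (ih s σ G hG h r).trans (hle _ _)
    | zero =>
      have h2 : ∀ r, σ r ≤ 2 * G := fun r => (h r).trans (by omega)
      have ih2 : ∀ τ : Fin k → ℕ, (∀ r, τ r ≤ 2 * G) → ∀ r,
          runProg P 0 τ r ≤ 2 ^ (P.length + 1) * G := fun τ hτ r => by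
        rw [← key]
        exact ih 0 τ (2 * G) (by omega) hτ r
      cases I with
      | add a b c =>
        simp only [runProg]
        refine ih2 _ fun r => ?_
        rw [Function.update_apply]
        split_ifs
        · have := h b
          have := h c
          omega
        · exact h2 r
      | reset a =>
        simp only [runProg]
        refine ih2 _ fun r => ?_
        rw [Function.update_apply]
        split_ifs
        · omega
        · exact h2 r
      | ifEq a b s =>
        intro r
        simp only [runProg]
        exact (ih _ σ G hG h r).trans (hle _ _)
      | ifNe a b s =>
        intro r
        simp only [runProg]
        exact (ih _ σ G hG h r).trans (hle _ _)

namespace LinkMachine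

variable (M : LinkMachine)

theorem regs_succ (i : ℕ) : M.regs (i + 1) = runProg M.program 0 (M.regs i) :=
  Function.iterate_succ_apply' _ _ _

theorem one_le_regs (i : ℕ) (r : Fin M.numRegs) : 1 ≤ M.regs i r := by
  induction i generalizing r with
  | zero => exact le_rfl
  | succ i ih =>
    rw [regs_succ]
    exact runProg_pos _ _ _ ih r

theorem regs_le_growth (i : ℕ) (r : Fin M.numRegs) : M.regs i r ≤ M.growth i :=
  Finset.le_sup (f := M.regs i) (Finset.mem_univ r)

variable {M}

theorem exists_regs_eq_growth (hk : 0 < M.numRegs) (i : ℕ) :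
    ∃ r, M.regs i r = M.growth i := by
  have : Nonempty (Fin M.numRegs) := ⟨⟨0, hk⟩⟩
  obtain ⟨r, -, hr⟩ := Finset.exists_mem_eq_sup Finset.univ Finset.univ_nonempty (M.regs i)
  exact ⟨r, hr.symm⟩

theorem one_le_growth (hk : 0 < M.numRegs) (i : ℕ) : 1 ≤ M.growth i :=
  (M.one_le_regs i ⟨0, hk⟩).trans (M.regs_le_growth i _)

theorem growth_zero_le : M.growth 0 ≤ 1 := Finset.sup_le fun _ _ => le_rfl

theorem growth_succ_le (hk : 0 < M.numRegs) (i : ℕ) :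
    M.growth (i + 1) ≤ 2 ^ M.len * M.growth i := by
  refine Finset.sup_le fun r _ => ?_
  rw [regs_succ]
  exact runProg_le _ _ _ _ (one_le_growth hk i) (M.regs_le_growth i) r

variable (M)

/-- A distance along a row: the link edges of a node at height `i` are known to represent register
values if no error occurs in this many columns to the right of the node. -/
def margin (i : ℕ) : ℕ := 1 + 2 ^ M.len * ∑ l ∈ Finset.range i, M.growth l

theorem margin_succ (i : ℕ) : M.margin (i + 1) = M.margin i + 2 ^ M.len * M.growth i := by
  rw [margin, margin, Finset.sum_range_succ]
  ring

variable {M}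

theorem growth_le_margin (hk : 0 < M.numRegs) (i : ℕ) : M.growth i ≤ M.margin i := by
  cases i with
  | zero => exact growth_zero_le.trans (Nat.le_add_right _ _)
  | succ i =>
    rw [margin_succ]
    exact (growth_succ_le hk i).trans (Nat.le_add_left _ _)

theorem margin_succ_le (hmono : Monotone M.growth) (i : ℕ) :
    M.margin (i + 1) ≤ 1 + 2 ^ M.len * ((i + 1) * M.growth i) := by
  have : ∑ l ∈ Finset.range (i + 1), M.growth l ≤ (i + 1) * M.growth i := by
    refine (Finset.sum_le_card_nsmul _ _ (M.growth i) fun l hl => ?_).trans (by simp)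
    exact hmono (by rw [Finset.mem_range] at hl; omega)
  unfold margin
  gcongr

end LinkMachine

/-! ### Nodes reached by edge labels -/

theorem LabelledGraph.next_eq_some {Lab V : Type} {X : LabelledGraph Lab V} {l : Lab} {v u : V} :
    X.next l v = some u ↔ X.Edge l v u ∧ ∀ w, X.Edge l v w → w = u := by
  unfold LabelledGraph.next
  split_ifs with h
  · rw [Option.some_inj]
    refine ⟨fun hu => hu ▸ h.choose_spec, fun hu => h.unique h.choose_spec.1 hu.1⟩
  · simp only [false_iff]
    exact fun hu => h ⟨u, hu.1, hu.2⟩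

theorem LabelledGraph.next_adj {Lab V : Type} {X : LabelledGraph Lab V} {l : Lab} {v u : V}
    (h : X.next l v = some u) : X.graph.Adj v u := (LabelledGraph.next_eq_some.1 h).1.1

theorem LabelledGraph.exists_next {Lab V : Type} {X : LabelledGraph Lab V} {l : Lab} {v : V}
    (h : ∃! u, X.Edge l v u) : ∃ u, X.next l v = some u :=
  h.imp fun _ hu => LabelledGraph.next_eq_some.2 hu

theorem nextLink_eq {k p : ℕ} {V : Type} (X : LabelledGraph (ELabel k p) V) (r : Fin k) (v : V) :
    nextLink X r p v = X.next (.link r (Fin.last p)) v := dif_pos (Nat.lt_succ_self p)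

theorem nextLink_adj {k p : ℕ} {V : Type} {X : LabelledGraph (ELabel k p) V} {r : Fin k} {i : ℕ}
    {v u : V} (h : nextLink X r i v = some u) : X.graph.Adj v u := by
  unfold nextLink at h
  split_ifs at h
  exact LabelledGraph.next_adj h

/-- On a row of distinct nodes, the link edges represent an execution of the program: if before a
list `P` of instructions the links lead as far as the register values tell, then so they do
after `P`, in a slightly smaller part of the row. -/
theorem nextLink_runProg {k p : ℕ} {V : Type} {X : LabelledGraph (ELabel k p) V} {y : ℕ → V}
    {j : ℕ} (hright : ∀ s < j, nextDir X .R (y s) = some (y (s + 1)))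
    (hinj : ∀ s < j, ∀ s' < j, y s = y s' → s = s')
    (P : List (Instr k)) (q skip : ℕ) (σ : Fin k → ℕ) (m G : ℕ) (hG : 1 ≤ G) (hGm : G ≤ m)
    (hσ : ∀ r, σ r ≤ G) (hP : ∀ s, s + m < j → ProgOK X (y s) P q skip)
    (h : ∀ s, s + m < j → ∀ r, nextLink X r q (y s) = some (y (s + σ r))) :
    ∀ s, s + m + 2 ^ P.length * G < j + G → ∀ r,
      nextLink X r (q + P.length) (y s) = some (y (s + runProg P skip σ r)) := by
  induction P generalizing q skip σ m G with
  | nil =>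
    intro s hs r
    simp only [List.length_nil, pow_zero, one_mul] at hs
    exact h s (by omega) r
  | cons I P ih =>
    intro s hs r
    have hpow : 1 ≤ 2 ^ P.length := Nat.one_le_two_pow
    -- the case that the registers do not change
    have same : ∀ skip', (∀ s, s + m < j → Unchanged X (y s) q ∅ ∧ ProgOK X (y s) P (q + 1) skip') →
        nextLink X r (q + (I :: P).length) (y s) = some (y (s + runProg P skip' σ r)) := by
      intro skip' hs'
      have := ih (q + 1) skip' σ m G hG hGm hσ (fun s hs => (hs' s hs).2) (fun s hs r => by
        rw [← (hs' s hs).1 r (by simp)]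
        exact h s hs r) s (by
          rw [List.length_cons, pow_succ] at hs
          nlinarith) r
      rwa [List.length_cons, add_comm P.length 1, ← add_assoc]
    -- the case that a single register changes
    have change : ∀ a val, val ≤ 2 * G → (∀ s, s + (m + G) < j →
        nextLink X a (q + 1) (y s) = some (y (s + val)) ∧ Unchanged X (y s) q {a} ∧
        ProgOK X (y s) P (q + 1) 0) →
        nextLink X r (q + (I :: P).length) (y s) =
          some (y (s + runProg P 0 (Function.update σ a val) r)) := by
      intro a val hval hs'
      have := ih (q + 1) 0 (Function.update σ a val) (m + G) (2 * G) (by omega) (by omega)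
        (fun r => by
          rw [Function.update_apply]
          split_ifs
          · exact hval
          · exact (hσ r).trans (by omega))
        (fun s hs => (hs' s hs).2.2) (fun s hs r => by
          rw [Function.update_apply]
          split_ifs with hr
          · rw [hr]
            exact (hs' s hs).1
          · rw [← (hs' s hs).2.1 r (by simpa using hr)]
            exact h s (by omega) r) s (by
          rw [List.length_cons, pow_succ] at hs
          nlinarith) r
      rwa [List.length_cons, add_comm P.length 1, ← add_assoc]
    have test : ∀ a b s, s + m < j →
        (nextLink X a q (y s) = nextLink X b q (y s) ↔ σ a = σ b) := by
      intro a b s hs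
      rw [h s hs a, h s hs b, Option.some_inj]
      refine ⟨fun he => ?_, fun he => by rw [he]⟩
      have h1 := hσ a
      have h2 := hσ b
      have := hinj _ (by omega) _ (by omega) he
      omega
    cases skip with
    | succ skip =>
      have := same skip fun s hs => by simpa only [ProgOK] using hP s hs
      simpa only [runProg] using this
    | zero =>
      cases I with
      | add a b c =>
        simp only [runProg]
        refine change a _ (by have := hσ b; have := hσ c; omega) fun s hs => ?_
        have hPs := hP s (by omega)
        simp only [ProgOK] at hPs
        refine ⟨?_, hPs.2⟩
        have hb := hσ b
        rw [hPs.1, h s (by omega) b, Option.bind_some, h (s + σ b) (by omega) c, add_assoc]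
      | reset a =>
        simp only [runProg]
        refine change a _ (by omega) fun s hs => ?_
        have hPs := hP s (by omega)
        simp only [ProgOK] at hPs
        refine ⟨?_, hPs.2⟩
        rw [hPs.1, hright s (by omega)]
      | ifEq a b n =>
        simp only [runProg]
        refine same _ fun s hs => ?_
        have hPs := hP s hs
        simp only [ProgOK, test a b s hs] at hPs
        exact hPs
      | ifNe a b n =>
        simp only [runProg]
        refine same _ fun s hs => ?_
        have hPs := hP s hs
        simp only [ProgOK, ne_eq, test a b s hs] at hPs
        exact hPs

/-! ### Correct parts of the grid -/

section Geometry

variable {M : LinkMachine} {V : Type} {X : LabelledGraph M.Labels V} {x : ℕ → ℕ → V} {j h : ℕ}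

/-- The nodes `x s i` with `s < j` and `i ≤ h` satisfy the local constraints and form a grid, with
column `s` and height `i`, of which the nodes `x s 0` are the bottom row. -/
structure IsRegion (M : LinkMachine) (X : LabelledGraph M.Labels V) (x : ℕ → ℕ → V) (j h : ℕ) :
    Prop where
  localOK : ∀ s < j, ∀ i ≤ h, LocalOK M X (x s i)
  up : ∀ s < j, ∀ i < h, nextDir X .U (x s i) = some (x s (i + 1))
  down : ∀ s < j, ∀ i < h, nextDir X .D (x s (i + 1)) = some (x s i)
  right : ∀ s < j, ∀ i ≤ h, nextDir X .R (x s i) = some (x (s + 1) i)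
  bottom : ∀ s < j, ¬ X.Has (.dir .D) (x s 0)

namespace IsRegion

theorem has_down (hR : IsRegion M X x j h) {s i : ℕ} (hs : s < j) (hi : i < h) :
    X.Has (.dir .D) (x s (i + 1)) :=
  ⟨_, (LabelledGraph.next_eq_some.1 (hR.down s hs i hi)).1⟩

theorem eq_of_eq_add (hR : IsRegion M X x j h) (hinj : ∀ s < j, ∀ s' < j, x s 0 = x s' 0 → s = s')
    {s s' i d : ℕ} (hs : s < j) (hs' : s' < j) (hi : i + d ≤ h) (he : x s i = x s' (i + d)) :
    s = s' ∧ d = 0 := by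
  induction i with
  | zero =>
    cases d with
    | zero => exact ⟨hinj s hs s' hs' he, rfl⟩
    | succ d =>
      rw [Nat.zero_add] at he hi
      exact absurd (he ▸ hR.has_down hs' hi) (hR.bottom s hs)
  | succ i ih =>
    refine ih (by omega) ?_
    have h1 := hR.down s hs i (by omega)
    rw [he, show i + 1 + d = i + d + 1 by ring, hR.down s' hs' (i + d) (by omega)] at h1
    exact (Option.some_inj.1 h1).symm

theorem eq_of_eq (hR : IsRegion M X x j h) (hinj : ∀ s < j, ∀ s' < j, x s 0 = x s' 0 → s = s')
    {s s' i i' : ℕ} (hs : s < j) (hs' : s' < j) (hi : i ≤ h) (hi' : i' ≤ h)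
    (he : x s i = x s' i') : s = s' ∧ i = i' := by
  rcases le_total i i' with hle | hle
  · obtain ⟨d, rfl⟩ := Nat.exists_eq_add_of_le hle
    obtain ⟨h1, h2⟩ := hR.eq_of_eq_add hinj hs hs' hi' he
    exact ⟨h1, by omega⟩
  · obtain ⟨d, rfl⟩ := Nat.exists_eq_add_of_le hle
    obtain ⟨h1, h2⟩ := hR.eq_of_eq_add hinj hs' hs hi he.symm
    exact ⟨h1.symm, by omega⟩

theorem nextLink_len (hR : IsRegion M X x j h)
    (hinj : ∀ s < j, ∀ s' < j, x s 0 = x s' 0 → s = s') (hk : 0 < M.numRegs) {i : ℕ} (hi : i ≤ h)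
    (h0 : ∀ s, s + M.margin i < j → ∀ r, nextLink X r 0 (x s i) = some (x (s + M.regs i r) i))
    {s : ℕ} (hs : s + M.margin (i + 1) < j) (r : Fin M.numRegs) :
    nextLink X r M.len (x s i) = some (x (s + M.regs (i + 1) r) i) := by
  have := nextLink_runProg (fun s hs => hR.right s hs i hi)
    (fun s hs s' hs' he => (hR.eq_of_eq hinj hs hs' hi hi he).1) M.program 0 0 (M.regs i)
    (M.margin i) (M.growth i) (LinkMachine.one_le_growth hk i) (LinkMachine.growth_le_margin hk i)
    (M.regs_le_growth i) (fun s hs => (hR.localOK s (by omega) i hi).2.2.2.1) h0 s (by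
      rw [M.margin_succ] at hs
      unfold LinkMachine.len at hs
      omega) r
  rwa [zero_add, ← M.regs_succ] at this

/-- At height `i` of a correct part of the grid, the links lead as far as the values of the registers
after `i` executions of the program. -/
theorem nextLink_zero (hR : IsRegion M X x j h)
    (hinj : ∀ s < j, ∀ s' < j, x s 0 = x s' 0 → s = s') (hk : 0 < M.numRegs) {i : ℕ} (hi : i ≤ h) :
    ∀ s, s + M.margin i < j → ∀ r, nextLink X r 0 (x s i) = some (x (s + M.regs i r) i) := by
  induction i with
  | zero =>
    intro s hs r
    rw [(hR.localOK s (by omega) 0 (by omega)).2.2.1.1 (hR.bottom s (by omega)) r,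
      hR.right s (by omega) 0 (by omega)]
    rfl
  | succ i ih =>
    intro s hs r
    have hs' : s < j := by omega
    rw [(hR.localOK s hs' (i + 1) hi).2.2.1.2 (hR.has_down hs' hi) r]
    have hlen := hR.nextLink_len hinj hk (by omega) (ih (by omega)) hs r
    rw [nextLink_eq] at hlen
    have hle : M.regs (i + 1) r ≤ M.margin (i + 1) :=
      (M.regs_le_growth _ _).trans (LinkMachine.growth_le_margin hk _)
    have h1 := hR.down s hs' i hi
    have h2 := hR.up (s + M.regs (i + 1) r) (by omega) i hi
    unfold nextDir at h1 h2
    simp [LabelledGraph.follow, h1, hlen, h2]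

/-- A correct part of the grid that reaches the top row is not much wider than `g`, unless it wraps
around: the `3`-cycles of the top row would not close up. -/
theorem width_le_of_top (hR : IsRegion M X x j h)
    (hinj : ∀ s < j, ∀ s' < j, x s 0 = x s' 0 → s = s') (hk : 0 < M.numRegs)
    (htop : ¬ X.Has (.dir .U) (x 0 h)) : j ≤ M.margin (h + 1) + 2 * M.growth (h + 1) := by
  by_contra! hj
  obtain ⟨r, hr⟩ := (hR.localOK 0 (by omega) h le_rfl).2.2.2.2 htop
  have hlen : ∀ s, s + M.margin (h + 1) < j →
      X.next (.link r (Fin.last M.len)) (x s h) = some (x (s + M.regs (h + 1) r) h) := by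
    intro s hs
    rw [← nextLink_eq]
    exact hR.nextLink_len hinj hk le_rfl (hR.nextLink_zero hinj hk le_rfl) hs r
  have hg := M.regs_le_growth (h + 1) r
  have hg1 := M.one_le_regs (h + 1) r
  have hgm := LinkMachine.growth_le_margin hk (h + 1)
  simp only [LabelledGraph.follow, hlen 0 (by omega), Option.bind_some,
    hlen (0 + M.regs (h + 1) r) (by omega),
    hlen (0 + M.regs (h + 1) r + M.regs (h + 1) r) (by omega), Option.some_inj] at hr
  have := (hR.eq_of_eq hinj (by omega) (by omega) le_rfl le_rfl hr).1
  omega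

/-- Descending from height `i` and following at each height the longest links as far as possible, a
node of the bottom row is reached in few steps. -/
theorem dist_le (hR : IsRegion M X x j h) (hconn : X.graph.Connected)
    (hinj : ∀ s < j, ∀ s' < j, x s 0 = x s' 0 → s = s') (hk : 0 < M.numRegs) {i : ℕ} (hi : i ≤ h) :
    ∀ n s, s < j → j ≤ s + M.margin i + n * M.growth i →
      X.graph.dist (x s i) (x j 0) ≤ n + i * (2 ^ M.len + 1) + 1 := by
  have hstep : ∀ {u w : V}, X.graph.Adj u w → X.graph.dist u (x j 0) ≤
      1 + X.graph.dist w (x j 0) := fun {u w} huw => by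
    rw [← SimpleGraph.dist_eq_one_iff_adj.2 huw]
    exact hconn.dist_triangle
  induction i with
  | zero =>
    intro n
    induction n with
    | zero =>
      intro s hs hle
      simp only [LinkMachine.margin, Finset.range_zero, Finset.sum_empty] at hle
      obtain rfl : j = s + 1 := by omega
      exact (SimpleGraph.dist_eq_one_iff_adj.2
        (LabelledGraph.next_adj (hR.right s hs 0 (by omega)))).le.trans (by omega)
    | succ n ihn =>
      intro s hs hle
      by_cases hm : s + M.margin 0 < j
      · obtain ⟨r, hr⟩ := LinkMachine.exists_regs_eq_growth hk 0
        have hlink := hR.nextLink_zero hinj hk hi s hm r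
        have hgm := LinkMachine.growth_le_margin hk 0
        rw [hr] at hlink
        have := ihn (s + M.growth 0) (by omega) (by rw [add_mul, one_mul] at hle; omega)
        have := hstep (nextLink_adj hlink)
        omega
      · exact (ihn s hs (by omega)).trans (by omega)
  | succ i ih =>
    intro n
    induction n with
    | zero =>
      intro s hs hle
      have h1 := ih (by omega) (2 ^ M.len) s hs (by rw [M.margin_succ] at hle; omega)
      have h2 := hstep (LabelledGraph.next_adj (hR.down s hs i hi))
      rw [add_mul, one_mul]
      omega
    | succ n ihn =>
      intro s hs hle
      by_cases hm : s + M.margin (i + 1) < j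
      · obtain ⟨r, hr⟩ := LinkMachine.exists_regs_eq_growth hk (i + 1)
        have hlink := hR.nextLink_zero hinj hk hi s hm r
        have hgm := LinkMachine.growth_le_margin hk (i + 1)
        rw [hr] at hlink
        have := ihn (s + M.growth (i + 1)) (by omega) (by rw [add_mul, one_mul] at hle; omega)
        have := hstep (nextLink_adj hlink)
        omega
      · exact (ihn s hs (by omega)).trans (by omega)

theorem dist_up_le (hR : IsRegion M X x j h) (hconn : X.graph.Connected) (hj : 0 < j) {i : ℕ}
    (hi : i ≤ h) : X.graph.dist (x 0 0) (x 0 i) ≤ i := by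
  induction i with
  | zero => simp
  | succ i ih =>
    have h1 := SimpleGraph.dist_eq_one_iff_adj.2
      (LabelledGraph.next_adj (hR.up 0 hj i hi))
    have h2 := hconn.dist_triangle (u := x 0 0) (v := x 0 i) (w := x 0 (i + 1))
    have := ih (by omega)
    omega

end IsRegion

end Geometry

/-! ### Columns without errors -/

section Columns

/-- The right neighbour of a node; a node without right neighbour is its own one. -/
def rightNode {k p : ℕ} {V : Type} (X : LabelledGraph (ELabel k p) V) (v : V) : V :=
  (nextDir X .R v).getD v

/-- The upper neighbour of a node; a node without upper neighbour is its own one. -/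
def upNode {k p : ℕ} {V : Type} (X : LabelledGraph (ELabel k p) V) (v : V) : V :=
  (nextDir X .U v).getD v

open Classical in
/-- The input of the first node that outputs `E` among `v` and the `t` nodes above it, if there is
such a node. -/
def errorAbove (M : LinkMachine) {V : Type} (X : LabelledGraph M.Labels V) : ℕ → V → Option Bool
  | 0, v => if NearWitness M X v then some (X.input v) else none
  | t + 1, v => if NearWitness M X v then some (X.input v) else
      (nextDir X .U v).bind (errorAbove M X t)

variable {M : LinkMachine} {V : Type} {X : LabelledGraph M.Labels V}

theorem localOK_of_not_nearWitness {v : V} (h : ¬ NearWitness M X v) : LocalOK M X v := by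
  by_contra hv
  exact h (Or.inl hv)

theorem localOK_of_adj {v u : V} (h : ¬ NearWitness M X v) (huv : X.graph.Adj v u) :
    LocalOK M X u := by
  by_contra hu
  exact h (Or.inr ⟨u, huv, hu⟩)

theorem not_nearWitness_of_errorAbove {t : ℕ} {v : V} (h : errorAbove M X t v = none) :
    ¬ NearWitness M X v := by
  intro hv
  cases t <;> simp [errorAbove, hv] at h

theorem errorAbove_succ {t : ℕ} {v u : V} (hv : ¬ NearWitness M X v)
    (hu : nextDir X .U v = some u) : errorAbove M X (t + 1) v = errorAbove M X t u := by
  simp [errorAbove, hv, hu]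

theorem errorAbove_of_nearWitness {t : ℕ} {v : V} (hv : NearWitness M X v) :
    errorAbove M X t v = some (X.input v) := by
  cases t <;> simp [errorAbove, hv]

theorem errorAbove_mono {t : ℕ} {v : V} {b : Bool} (h : errorAbove M X t v = some b) :
    errorAbove M X (t + 1) v = some b := by
  induction t generalizing v with
  | zero =>
    by_cases hv : NearWitness M X v
    · rwa [errorAbove_of_nearWitness hv] at h ⊢
    · simp [errorAbove, hv] at h
  | succ t ih =>
    by_cases hv : NearWitness M X v
    · rwa [errorAbove_of_nearWitness hv] at h ⊢
    · rw [errorAbove, if_neg hv, Option.bind_eq_some_iff] at h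
      obtain ⟨u, hu, hb⟩ := h
      rw [errorAbove_succ hv hu, ih hb]

theorem nextDir_right {v : V} (h : LocalOK M X v) : nextDir X .R v = some (rightNode X v) := by
  obtain ⟨u, hu⟩ := LabelledGraph.exists_next h.1.2.2.1
  change nextDir X .R v = some u at hu
  simp [rightNode, hu]

theorem nextDir_up {v : V} (h : LocalOK M X v) (hU : X.Has (.dir .U) v) :
    nextDir X .U v = some (upNode X v) := by
  obtain ⟨u, hu⟩ := LabelledGraph.exists_next (h.1.2.2.2.1 hU)
  change nextDir X .U v = some u at hu
  simp [upNode, hu]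

/-- The local constraints at both ends of an edge labelled with a direction make the other end label
it with the opposite direction, and no other edge. -/
theorem nextDir_opp {d : Dir} {v u : V} (hv : LocalOK M X v) (hu : LocalOK M X u)
    (h : nextDir X d v = some u) : nextDir X d.opp u = some v := by
  have hedge : X.Edge (.dir d.opp) u v := hv.2.1.1 d u (LabelledGraph.next_eq_some.1 h).1
  have huniq : ∃! w, X.Edge (.dir d.opp) u w := by
    cases d with
    | U => exact hu.1.2.2.2.2.1 ⟨v, hedge⟩
    | D => exact hu.1.2.2.2.1 ⟨v, hedge⟩
    | L => exact hu.1.2.2.1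
    | R => exact hu.1.2.1
  exact LabelledGraph.next_eq_some.2 ⟨hedge, fun w hw => huniq.unique hw hedge⟩

theorem rightNode_adj {v : V} (h : LocalOK M X v) : X.graph.Adj v (rightNode X v) :=
  LabelledGraph.next_adj (nextDir_right h)

theorem rightNode_inj {v u : V} (hv : ¬ NearWitness M X v) (hu : ¬ NearWitness M X u)
    (h : rightNode X v = rightNode X u) : v = u := by
  have hv' := localOK_of_not_nearWitness hv
  have hu' := localOK_of_not_nearWitness hu
  have hw := localOK_of_adj hv (rightNode_adj hv')
  have h1 := nextDir_opp hv' hw (nextDir_right hv')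
  have h2 := nextDir_opp hu' (h ▸ hw) (nextDir_right hu')
  rw [h] at h1
  exact Option.some_inj.1 (h1.symm.trans h2)

theorem not_has_down_rightNode {v : V} (h : LocalOK M X v) (hD : ¬ X.Has (.dir .D) v) :
    ¬ X.Has (.dir .D) (rightNode X v) :=
  h.2.1.2.2.1 hD _ (Or.inr (LabelledGraph.next_eq_some.1 (nextDir_right h)).1)

theorem not_has_down_iterate {v : V} {j : ℕ} (hD : ¬ X.Has (.dir .D) v)
    (hok : ∀ s < j, ¬ NearWitness M X ((rightNode X)^[s] v)) :
    ∀ s ≤ j, ¬ X.Has (.dir .D) ((rightNode X)^[s] v) := by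
  intro s
  induction s with
  | zero => exact fun _ => hD
  | succ s ih =>
    intro hs
    rw [Function.iterate_succ_apply']
    exact not_has_down_rightNode (localOK_of_not_nearWitness (hok s hs)) (ih (by omega))

/-- If a node occurs twice in a correct part of a row, then the row is a cycle. -/
theorem iterate_eq_self {v : V} {j : ℕ} (hok : ∀ s < j, ¬ NearWitness M X ((rightNode X)^[s] v))
    {i w : ℕ} (hi : i + w ≤ j) (hw : 1 ≤ w)
    (he : (rightNode X)^[i + w] v = (rightNode X)^[i] v) : (rightNode X)^[w] v = v := by
  induction i with
  | zero => simpa using he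
  | succ i ih =>
    rw [show i + 1 + w = i + w + 1 by omega, Function.iterate_succ_apply',
      Function.iterate_succ_apply'] at he
    exact ih (by omega) (rightNode_inj (hok _ (by omega)) (hok _ (by omega)) he)

/-- Columns without errors up to height `t` form a correct part of the grid, which extends to height
`t` or to the top row. -/
theorem exists_isRegion {v : V} {j t : ℕ} (hD : ¬ X.Has (.dir .D) v)
    (hok : ∀ s < j, errorAbove M X t ((rightNode X)^[s] v) = none) :
    ∃ h ≤ t, IsRegion M X (fun s i => (upNode X)^[i] ((rightNode X)^[s] v)) j h ∧
      (h < t → ¬ X.Has (.dir .U) ((upNode X)^[h] v)) := by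
  obtain ⟨h, hht, hhas, htop⟩ : ∃ h ≤ t, (∀ i < h, X.Has (.dir .U) ((upNode X)^[i] v)) ∧
      (h < t → ¬ X.Has (.dir .U) ((upNode X)^[h] v)) := by
    classical
    by_cases hall : ∀ i < t, X.Has (.dir .U) ((upNode X)^[i] v)
    · exact ⟨t, le_rfl, hall, fun h => absurd h (lt_irrefl t)⟩
    · push Not at hall
      have hex : ∃ i, ¬ X.Has (.dir .U) ((upNode X)^[i] v) := hall.imp fun i hi => hi.2
      obtain ⟨i, hit, hi⟩ := hall
      exact ⟨Nat.find hex, (Nat.find_le hi).trans hit.le,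
        fun i' hi' => not_not.1 (Nat.find_min hex hi'), fun _ => Nat.find_spec hex⟩
  refine ⟨h, hht, ?_, htop⟩
  have hNW : ∀ s < j, ¬ NearWitness M X ((rightNode X)^[s] v) :=
    fun s hs => not_nearWitness_of_errorAbove (hok s hs)
  -- the columns have the same height
  have hasU : ∀ i < h, (∀ s < j, errorAbove M X (t - i) ((upNode X)^[i] ((rightNode X)^[s] v)) =
      none ∧ nextDir X .R ((upNode X)^[i] ((rightNode X)^[s] v)) =
      some ((upNode X)^[i] ((rightNode X)^[s + 1] v))) → ∀ s ≤ j,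
      X.Has (.dir .U) ((upNode X)^[i] ((rightNode X)^[s] v)) := by
    intro i hi hrow s
    induction s with
    | zero => exact fun _ => hhas i hi
    | succ s ih =>
      intro hs
      by_contra hU
      obtain ⟨h1, h2⟩ := hrow s hs
      have hNW1 := not_nearWitness_of_errorAbove h1
      have hu : LocalOK M X ((upNode X)^[i] ((rightNode X)^[s + 1] v)) :=
        localOK_of_adj hNW1 (LabelledGraph.next_adj h2)
      have h3 := nextDir_opp (localOK_of_not_nearWitness hNW1) hu h2
      exact hu.2.1.2.2.2 hU _ (Or.inl (LabelledGraph.next_eq_some.1 h3).1)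
        (ih (by omega))
  have hrow : ∀ i ≤ h, ∀ s < j,
      errorAbove M X (t - i) ((upNode X)^[i] ((rightNode X)^[s] v)) = none ∧
      nextDir X .R ((upNode X)^[i] ((rightNode X)^[s] v)) =
        some ((upNode X)^[i] ((rightNode X)^[s + 1] v)) := by
    intro i
    induction i with
    | zero =>
      intro _ s hs
      refine ⟨hok s hs, ?_⟩
      simp only [Function.iterate_zero, id_eq, Function.iterate_succ_apply' (rightNode X)]
      exact nextDir_right (localOK_of_not_nearWitness (hNW s hs))
    | succ i ih =>
      intro hi s hs
      have hrow := ih (by omega)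
      obtain ⟨h1, h2⟩ := hrow s hs
      have hU := hasU i hi hrow s hs.le
      have hNW1 := not_nearWitness_of_errorAbove h1
      have hloc1 := localOK_of_not_nearWitness hNW1
      have hup := nextDir_up hloc1 hU
      rw [show t - i = t - (i + 1) + 1 by omega, errorAbove_succ hNW1 hup] at h1
      simp only [Function.iterate_succ_apply' (upNode X)]
      refine ⟨h1, ?_⟩
      have hNW2 := not_nearWitness_of_errorAbove h1
      have hloc2 := localOK_of_not_nearWitness hNW2
      have hdown := nextDir_opp hloc1 hloc2 hup
      change nextDir X .D _ = _ at hdown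
      have hgrid := hloc2.2.1.2.1 ⟨_, (LabelledGraph.next_eq_some.1 hdown).1⟩
      have hright := nextDir_right hloc2
      unfold nextDir at hdown h2 hright hgrid ⊢
      rw [hright] at hgrid ⊢
      simp only [LabelledGraph.follow, hdown, h2, Option.bind_some] at hgrid
      rw [Option.bind_eq_some_iff] at hgrid
      obtain ⟨w, hw, hw'⟩ := hgrid
      rw [Option.some_inj] at hw' ⊢
      subst hw'
      change _ = (X.next _ _).getD _
      rw [hw]
      rfl
  have hloc : ∀ s < j, ∀ i ≤ h, LocalOK M X ((upNode X)^[i] ((rightNode X)^[s] v)) :=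
    fun s hs i hi =>
      localOK_of_not_nearWitness (not_nearWitness_of_errorAbove (hrow i hi s hs).1)
  have hup : ∀ s < j, ∀ i < h, nextDir X .U ((upNode X)^[i] ((rightNode X)^[s] v)) =
      some ((upNode X)^[i + 1] ((rightNode X)^[s] v)) := by
    intro s hs i hi
    rw [Function.iterate_succ_apply']
    exact nextDir_up (hloc s hs i hi.le) (hasU i hi (hrow i hi.le) s hs.le)
  exact
    { localOK := hloc
      up := hup
      down := fun s hs i hi =>
        nextDir_opp (hloc s hs i hi.le) (hloc s hs (i + 1) hi) (hup s hs i hi)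
      right := fun s hs i hi => (hrow i hi s hs).2
      bottom := fun s hs => not_has_down_iterate hD hNW s hs.le }

/-- If the first `j` columns contain no errors, then the row can be followed over these columns
within a small part of the graph: by links, or because the row is a short cycle. -/
theorem dist_iterate_rightNode_le (hconn : X.graph.Connected)
    (hk : 0 < M.numRegs) {v : V} {j t K : ℕ} (ht : 1 ≤ t) (hj : j ≤ K * (M.speed t + 1))
    (hD : ¬ X.Has (.dir .D) v)
    (hok : ∀ s < j, errorAbove M X t ((rightNode X)^[s] v) = none) :
    X.graph.dist v ((rightNode X)^[j] v) ≤ (2 * K + 4 * 2 ^ M.len + 3) * t := by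
  induction j using Nat.strong_induction_on with
  | _ j ih =>
  rcases Nat.eq_zero_or_pos j with rfl | hj0
  · simp
  by_cases hinj : ∀ s < j, ∀ s' < j, (rightNode X)^[s] v = (rightNode X)^[s'] v → s = s'
  · obtain ⟨h, hht, hR, htop⟩ := exists_isRegion hD hok
    have hup := hR.dist_up_le hconn hj0 le_rfl
    obtain ⟨n, hn, hjn⟩ : ∃ n, n ≤ 2 * K * t + 3 * 2 ^ M.len * t ∧
        j ≤ 0 + M.margin h + n * M.growth h := by
      rcases hht.lt_or_eq with hlt | rfl
      · refine ⟨3 * 2 ^ M.len, (Nat.le_mul_of_pos_right _ ht).trans (Nat.le_add_left _ _), ?_⟩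
        have h1 := hR.width_le_of_top hinj hk (htop hlt)
        have h2 := LinkMachine.growth_succ_le hk h
        rw [M.margin_succ] at h1
        rw [mul_assoc]
        omega
      · refine ⟨K * (h + 1), ?_, hj.trans ?_⟩
        · nlinarith [Nat.zero_le (2 ^ M.len * h), Nat.zero_le K]
        · have := LinkMachine.one_le_growth hk h
          refine le_trans ?_ (Nat.le_add_left _ _)
          rw [mul_assoc]
          refine Nat.mul_le_mul_left _ ?_
          unfold LinkMachine.speed
          nlinarith
    have h1 := hR.dist_le hconn hinj hk le_rfl n 0 hj0 hjn
    have h2 := hconn.dist_triangle (u := v) (v := (upNode X)^[h] v) (w := (rightNode X)^[j] v)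
    simp only [Function.iterate_zero, id_eq] at h1 hup
    have h3 : h * (2 ^ M.len + 1) ≤ t * (2 ^ M.len + 1) := Nat.mul_le_mul_right _ hht
    calc X.graph.dist v ((rightNode X)^[j] v)
        ≤ t + (2 * K * t + 3 * 2 ^ M.len * t + t * (2 ^ M.len + 1) + t) := by omega
      _ = _ := by ring
  · push Not at hinj
    obtain ⟨a, ha, b, hb, hab, hne⟩ := hinj
    have hNW : ∀ s < j, ¬ NearWitness M X ((rightNode X)^[s] v) :=
      fun s hs => not_nearWitness_of_errorAbove (hok s hs)
    obtain ⟨w, hw1, hwj, hw⟩ : ∃ w, 1 ≤ w ∧ w ≤ j ∧ (rightNode X)^[w] v = v := by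
      rcases lt_or_gt_of_ne hne with hlt | hlt
      · refine ⟨b - a, by omega, by omega, iterate_eq_self (i := a) hNW (by omega) (by omega) ?_⟩
        rw [Nat.add_sub_cancel' hlt.le, hab]
      · refine ⟨a - b, by omega, by omega, iterate_eq_self (i := b) hNW (by omega) (by omega) ?_⟩
        rw [Nat.add_sub_cancel' hlt.le, hab]
    have he : (rightNode X)^[j] v = (rightNode X)^[j - w] v := by
      rw [← congrArg (rightNode X)^[j - w] hw, ← Function.iterate_add_apply,
        Nat.sub_add_cancel hwj]
    rw [he]
    exact ih (j - w) (by omega) (by omega) fun s hs => hok s (by omega)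

/-- A row cannot close up after one or two steps. -/
theorem three_le_of_iterate_eq {v : V} (hv : ¬ NearWitness M X v) {w : ℕ} (hw : 1 ≤ w)
    (he : (rightNode X)^[w] v = v) : 3 ≤ w := by
  have hloc := localOK_of_not_nearWitness hv
  have hadj := rightNode_adj hloc
  have hloc' := localOK_of_adj hv hadj
  by_contra! hlt
  have hcase : w = 1 ∨ w = 2 := by omega
  rcases hcase with rfl | rfl
  · rw [Function.iterate_one] at he
    exact hadj.ne he.symm
  · have he' : rightNode X (rightNode X v) = v := he
    have h1 := nextDir_right hloc'
    rw [he'] at h1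
    have h2 := nextDir_opp hloc hloc' (nextDir_right hloc)
    have := hloc'.1.2.2.2.2.2.2 .R Dir.R.opp v (LabelledGraph.next_eq_some.1 h1).1
      (LabelledGraph.next_eq_some.1 h2).1
    cases this

end Columns

/-! ### The output of a node and its locality -/

section Output

variable {M : LinkMachine} {Γ V W : Type}

open Classical in
/-- The least `s ≤ H` such that there is an error at height at most `t` in column `s` to the right of
`v`, if there is one. -/
def firstError (M : LinkMachine) (X : LabelledGraph M.Labels V) (t : ℕ) : ℕ → V → Option ℕ
  | 0, v => if errorAbove M X t v = none then none else some 0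
  | H + 1, v => if errorAbove M X t v = none then
      (firstError M X t H (rightNode X v)).map (· + 1) else some 0

open Classical in
/-- The output of `v`: a pointer leads up to an error, or else to the right to a column with an error;
a node of the bottom row with no error in sight applies the rule `B` to its row. The counter of a
pointer to the right is the parity of the distance to the column with the error. -/
def output (M : LinkMachine) (B : (ℕ → ℕ × Bool) → Γ) (t H : ℕ) (X : LabelledGraph M.Labels V)
    (ident : V → ℕ) (v : V) : Out Γ :=
  if NearWitness M X v then .err else
    match errorAbove M X t v with
    | some b => .ptr .up 0 b
    | none => if X.Has (.dir .D) v then .empty else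
      match firstError M X t H v with
      | some s => .ptr .right s false
      | none => .sol (B fun s =>
          (ident ((rightNode X)^[s] v), X.input ((rightNode X)^[s] v)))

/-- The map `f` from the nodes of `X` to those of `Y` is an isomorphism on the radius-`n`
neighbourhood of a node. -/
def LocalIso {Lab : Type} (X : LabelledGraph Lab V) (Y : LabelledGraph Lab W) (f : V → W) :
    ℕ → V → Prop
  | 0, _ => True
  | n + 1, u => (∀ b, Y.graph.Adj (f u) b ↔ ∃ w, b = f w ∧ X.graph.Adj u w) ∧
      (∀ w, X.graph.Adj u w → Y.edgeLabels (f u) (f w) = X.edgeLabels u w) ∧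
      Y.input (f u) = X.input u ∧ ∀ w, X.graph.Adj u w → LocalIso X Y f n w

namespace LocalIso

section

variable {Lab : Type} {X : LabelledGraph Lab V} {Y : LabelledGraph Lab W} {f : V → W} {n : ℕ}
  {u : V}

theorem of_succ (h : LocalIso X Y f (n + 1) u) : LocalIso X Y f n u := by
  induction n generalizing u with
  | zero => trivial
  | succ n ih => exact ⟨h.1, h.2.1, h.2.2.1, fun w hw => ih (h.2.2.2 w hw)⟩

theorem mono {m : ℕ} (h : LocalIso X Y f n u) (hm : m ≤ n) : LocalIso X Y f m u := by
  induction n with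
  | zero => rwa [Nat.le_zero.1 hm]
  | succ n ih =>
    rcases Nat.le_succ_iff.1 hm with hm | rfl
    · exact ih h.of_succ hm
    · exact h

theorem edge_iff (h : LocalIso X Y f (n + 1) u) {l : Lab} {b : W} :
    Y.Edge l (f u) b ↔ ∃ w, b = f w ∧ X.Edge l u w := by
  constructor
  · rintro ⟨hadj, hl⟩
    obtain ⟨w, rfl, hw⟩ := (h.1 b).1 hadj
    exact ⟨w, rfl, hw, h.2.1 w hw ▸ hl⟩
  · rintro ⟨w, rfl, hw, hl⟩
    exact ⟨(h.1 _).2 ⟨w, rfl, hw⟩, (h.2.1 w hw).symm ▸ hl⟩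

theorem edge_map_iff (hf : Function.Injective f) (h : LocalIso X Y f (n + 1) u) {l : Lab} {w : V} :
    Y.Edge l (f u) (f w) ↔ X.Edge l u w := by
  rw [h.edge_iff]
  refine ⟨?_, fun hw => ⟨w, rfl, hw⟩⟩
  rintro ⟨w', hw', he⟩
  rwa [hf hw']

theorem has_iff (h : LocalIso X Y f (n + 1) u) {l : Lab} : Y.Has l (f u) ↔ X.Has l u := by
  unfold LabelledGraph.Has
  simp only [h.edge_iff]
  exact ⟨fun ⟨_, w, _, hw⟩ => ⟨w, hw⟩, fun ⟨w, hw⟩ => ⟨_, w, rfl, hw⟩⟩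

theorem existsUnique_iff (hf : Function.Injective f) (h : LocalIso X Y f (n + 1) u) {l : Lab} :
    (∃! b, Y.Edge l (f u) b) ↔ ∃! w, X.Edge l u w := by
  constructor
  · rintro ⟨b, hb, huniq⟩
    obtain ⟨w, rfl, hw⟩ := h.edge_iff.1 hb
    exact ⟨w, hw, fun w' hw' => hf (huniq _ (h.edge_iff.2 ⟨w', rfl, hw'⟩))⟩
  · rintro ⟨w, hw, huniq⟩
    refine ⟨f w, h.edge_iff.2 ⟨w, rfl, hw⟩, fun b hb => ?_⟩
    obtain ⟨w', rfl, hw'⟩ := h.edge_iff.1 hb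
    rw [huniq w' hw']

theorem next_map (hf : Function.Injective f) (h : LocalIso X Y f (n + 1) u) (l : Lab) :
    Y.next l (f u) = (X.next l u).map f := by
  by_cases hu : ∃! w, X.Edge l u w
  · obtain ⟨w, hw⟩ := LabelledGraph.exists_next hu
    rw [hw, Option.map_some, LabelledGraph.next_eq_some]
    have hw' := LabelledGraph.next_eq_some.1 hw
    refine ⟨h.edge_iff.2 ⟨w, rfl, hw'.1⟩, fun b hb => ?_⟩
    obtain ⟨w', rfl, he⟩ := h.edge_iff.1 hb
    rw [hw'.2 w' he]
  · have hu' := mt (h.existsUnique_iff hf).1 hu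
    simp [LabelledGraph.next, hu, hu']

theorem of_next (h : LocalIso X Y f (n + 1) u) {l : Lab} {w : V} (hw : X.next l u = some w) :
    LocalIso X Y f n w := h.2.2.2 w (LabelledGraph.next_adj hw)

theorem follow_map (hf : Function.Injective f) (ls : List Lab) (h : LocalIso X Y f ls.length u) :
    Y.follow ls (f u) = (X.follow ls u).map f := by
  induction ls generalizing u with
  | nil => rfl
  | cons l ls ih =>
    rw [LabelledGraph.follow, LabelledGraph.follow, h.next_map hf]
    cases hw : X.next l u with
    | none => rfl
    | some w => exact ih (h.of_next hw)

end

section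

variable {k p : ℕ} {X : LabelledGraph (ELabel k p) V} {Y : LabelledGraph (ELabel k p) W}
  {f : V → W} {n : ℕ} {u : V}

theorem nextLink_map (hf : Function.Injective f) (h : LocalIso X Y f (n + 1) u) (r : Fin k)
    (i : ℕ) : nextLink Y r i (f u) = (nextLink X r i u).map f := by
  unfold nextLink
  split_ifs
  · exact h.next_map hf _
  · rfl

theorem map_eq_iff (hf : Function.Injective f) {a b : Option V} :
    a.map f = b.map f ↔ a = b := (Option.map_injective hf).eq_iff

theorem basicOK_iff (hf : Function.Injective f) (h : LocalIso X Y f 1 u) :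
    BasicOK Y (f u) ↔ BasicOK X u := by
  unfold BasicOK
  simp only [h.existsUnique_iff hf, h.has_iff]
  refine and_congr_right fun _ => and_congr_right fun _ => and_congr_right fun _ =>
    and_congr_right fun _ => and_congr_right fun _ => and_congr_right fun _ => ?_
  simp only [h.edge_iff]
  constructor
  · exact fun H d d' w hd hd' => H d d' (f w) ⟨w, rfl, hd⟩ ⟨w, rfl, hd'⟩
  · rintro H d d' b ⟨w, rfl, hd⟩ ⟨w', hw', hd'⟩
    exact H d d' w hd (hf hw' ▸ hd')

theorem gridOK_iff (hf : Function.Injective f) (h : LocalIso X Y f 3 u) :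
    GridOK Y (f u) ↔ GridOK X u := by
  have h1 : LocalIso X Y f 1 u := h.mono (by omega)
  have hadj : ∀ d w, X.Edge (.dir d) u w → LocalIso X Y f 2 w := fun d w hw => h.2.2.2 w hw.1
  have hhas : ∀ d : Dir,
      (∀ b, Y.Edge (.dir .L) (f u) b ∨ Y.Edge (.dir .R) (f u) b → ¬ Y.Has (.dir d) b) ↔
      ∀ w, X.Edge (.dir .L) u w ∨ X.Edge (.dir .R) u w → ¬ X.Has (.dir d) w := by
    intro d
    constructor
    · intro H w hw
      have hw2 : LocalIso X Y f 2 w := hw.elim (hadj _ _) (hadj _ _)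
      rw [← hw2.has_iff]
      exact H (f w) (hw.imp (h.edge_map_iff hf).2 (h.edge_map_iff hf).2)
    · intro H b hb
      obtain ⟨w, rfl⟩ : ∃ w, b = f w := by
        rcases hb with hb | hb <;> obtain ⟨w, hw, -⟩ := h.edge_iff.1 hb <;> exact ⟨w, hw⟩
      have hw := hb.imp (h.edge_map_iff hf).1 (h.edge_map_iff hf).1
      have hw2 : LocalIso X Y f 2 w := hw.elim (hadj _ _) (hadj _ _)
      rw [hw2.has_iff]
      exact H w hw
  unfold GridOK
  refine and_congr ?_ (and_congr ?_ (and_congr ?_ ?_))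
  · constructor
    · intro H d w hw
      exact ((hadj d w hw).edge_map_iff hf).1 (H d (f w) ((h.edge_map_iff hf).2 hw))
    · intro H d b hb
      obtain ⟨w, rfl, hw⟩ := h.edge_iff.1 hb
      exact ((hadj d w hw).edge_map_iff hf).2 (H d w hw)
  · unfold nextDir
    rw [h.has_iff, h.follow_map hf [_, _, _], h.next_map hf, map_eq_iff hf]
  · rw [h.has_iff, hhas]
  · rw [h.has_iff, hhas]

theorem initOK_iff (hf : Function.Injective f) (h : LocalIso X Y f 3 u) :
    InitOK Y (f u) ↔ InitOK X u := by
  unfold InitOK nextDir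
  simp only [h.has_iff, h.nextLink_map hf, h.next_map hf, map_eq_iff hf]
  refine and_congr_right fun _ => forall_congr' fun _ => forall_congr' fun r => ?_
  rw [h.follow_map hf [_, _, _], map_eq_iff hf]

open Classical in
theorem progOK_iff (hf : Function.Injective f) (h : LocalIso X Y f 2 u) (P : List (Instr k))
    (i s : ℕ) : ProgOK Y (f u) P i s ↔ ProgOK X u P i s := by
  have hunch : ∀ i S, Unchanged Y (f u) i S ↔ Unchanged X u i S := by
    intro i S
    unfold Unchanged
    simp only [h.nextLink_map hf, map_eq_iff hf]
  have hbind : ∀ b c, (nextLink Y b i (f u)).bind (nextLink Y c i) =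
      ((nextLink X b i u).bind (nextLink X c i)).map f := by
    intro b c
    rw [h.nextLink_map hf]
    cases hw : nextLink X b i u with
    | none => rfl
    | some w => exact (h.2.2.2 w (nextLink_adj hw)).nextLink_map hf c i
  induction P generalizing i s with
  | nil => simp [ProgOK]
  | cons I P ih =>
    have ih' : ∀ s, ProgOK Y (f u) P (i + 1) s ↔ ProgOK X u P (i + 1) s := by
      intro s
      refine ih (i + 1) s fun b c => ?_
      rw [h.nextLink_map hf]
      cases hw : nextLink X b (i + 1) u with
      | none => rfl
      | some w => exact (h.2.2.2 w (nextLink_adj hw)).nextLink_map hf c _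
    cases s with
    | succ s => simp only [ProgOK, hunch, ih']
    | zero =>
      cases I with
      | add a b c =>
        simp only [ProgOK, hunch, ih', hbind, h.nextLink_map hf a, map_eq_iff hf]
      | reset a =>
        simp only [ProgOK, hunch, ih', nextDir, h.next_map hf, h.nextLink_map hf, map_eq_iff hf]
      | ifEq a b s => simp only [ProgOK, hunch, ih', h.nextLink_map hf, map_eq_iff hf]
      | ifNe a b s => simp only [ProgOK, hunch, ih', h.nextLink_map hf, map_eq_iff hf, ne_eq]

theorem topOK_iff (hf : Function.Injective f) (h : LocalIso X Y f 3 u) :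
    TopOK Y (f u) ↔ TopOK X u := by
  unfold TopOK
  rw [h.has_iff]
  refine forall_congr' fun _ => exists_congr fun r => ?_
  rw [h.follow_map hf [_, _, _], ← Option.map_some, map_eq_iff hf]

theorem rightNode_map (hf : Function.Injective f) (h : LocalIso X Y f (n + 1) u) :
    rightNode Y (f u) = f (rightNode X u) := by
  unfold rightNode nextDir
  rw [h.next_map hf]
  cases X.next (.dir .R) u <;> rfl

end

variable {X : LabelledGraph M.Labels V} {Y : LabelledGraph M.Labels W} {f : V → W} {u : V}

theorem localOK_iff (hf : Function.Injective f) (h : LocalIso X Y f 3 u) :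
    LocalOK M Y (f u) ↔ LocalOK M X u := by
  unfold LocalOK
  rw [(h.mono (by omega)).basicOK_iff hf, h.gridOK_iff hf, h.initOK_iff hf,
    (h.mono (by omega)).progOK_iff hf, h.topOK_iff hf]

theorem nearWitness_iff (hf : Function.Injective f) (h : LocalIso X Y f 4 u) :
    NearWitness M Y (f u) ↔ NearWitness M X u := by
  unfold NearWitness
  rw [h.of_succ.localOK_iff hf]
  refine or_congr_right ⟨?_, ?_⟩
  · rintro ⟨b, hb, hbad⟩
    obtain ⟨w, rfl, hw⟩ := (h.1 b).1 hb
    exact ⟨w, hw, by rwa [← (h.2.2.2 w hw).localOK_iff hf]⟩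
  · rintro ⟨w, hw, hbad⟩
    exact ⟨f w, (h.1 _).2 ⟨w, rfl, hw⟩, by rwa [(h.2.2.2 w hw).localOK_iff hf]⟩

open Classical in
theorem errorAbove_eq (hf : Function.Injective f) {t : ℕ} (h : LocalIso X Y f (t + 4) u) :
    errorAbove M Y t (f u) = errorAbove M X t u := by
  induction t generalizing u with
  | zero =>
    unfold errorAbove
    simp only [(h.mono (by omega)).nearWitness_iff hf, h.2.2.1]
  | succ t ih =>
    unfold errorAbove
    rw [show t + 1 + 4 = t + 4 + 1 by ring] at h
    simp only [(h.mono (by omega)).nearWitness_iff hf, h.2.2.1, nextDir, h.next_map hf]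
    cases hw : X.next (.dir .U) u with
    | none => rfl
    | some w => simp only [Option.map_some, Option.bind_some, ih (h.of_next hw)]

end LocalIso

variable {X : LabelledGraph M.Labels V} {Y : LabelledGraph M.Labels W} {f : V → W}

theorem firstError_eq_none {t H : ℕ} {v : V} (h : firstError M X t H v = none) :
    ∀ s ≤ H, errorAbove M X t ((rightNode X)^[s] v) = none := by
  induction H generalizing v with
  | zero =>
    intro s hs
    obtain rfl : s = 0 := by omega
    by_contra hv
    simp [firstError, show errorAbove M X t v ≠ none from hv] at h
  | succ H ih =>
    by_cases hv : errorAbove M X t v = none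
    · simp only [firstError, hv, if_true, Option.map_eq_none_iff] at h
      intro s hs
      cases s with
      | zero => exact hv
      | succ s => exact ih h s (by omega)
    · simp [firstError, hv] at h

theorem firstError_mono {t H : ℕ} {v : V} {s : ℕ} (h : firstError M X t H v = some s) :
    firstError M X t (H + 1) v = some s := by
  induction H generalizing v s with
  | zero =>
    by_cases hv : errorAbove M X t v = none
    · simp [firstError, hv] at h
    · simpa [firstError, hv] using h
  | succ H ih =>
    by_cases hv : errorAbove M X t v = none
    · rw [firstError, if_pos hv, Option.map_eq_some_iff] at h ⊢
      obtain ⟨a, ha, rfl⟩ := h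
      exact ⟨a, ih ha, rfl⟩
    · rw [firstError, if_neg hv] at h ⊢
      exact h

theorem exists_of_firstError {t H : ℕ} {v : V} {s : ℕ} (hv : errorAbove M X t v = none)
    (h : firstError M X t H v = some s) :
    ∃ s', s = s' + 1 ∧ firstError M X t H (rightNode X v) = some s' := by
  cases H with
  | zero => simp [firstError, hv] at h
  | succ H =>
    rw [firstError, if_pos hv, Option.map_eq_some_iff] at h
    obtain ⟨a, ha, rfl⟩ := h
    exact ⟨a, rfl, firstError_mono ha⟩

theorem LocalIso.firstError_eq (hf : Function.Injective f) {t H : ℕ} {v : V}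
    (h : ∀ s ≤ H, (∀ i < s, errorAbove M X t ((rightNode X)^[i] v) = none) →
      LocalIso X Y f (t + 5) ((rightNode X)^[s] v)) :
    firstError M Y t H (f v) = firstError M X t H v ∧
      (firstError M X t H v = none →
        ∀ s ≤ H, (rightNode Y)^[s] (f v) = f ((rightNode X)^[s] v)) := by
  have hv : LocalIso X Y f (t + 5) v := h 0 (Nat.zero_le _) (by simp)
  have he := hv.of_succ.errorAbove_eq hf
  induction H generalizing v with
  | zero =>
    simp only [firstError, he]
    refine ⟨trivial, fun _ s hs => ?_⟩
    obtain rfl : s = 0 := by omega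
    rfl
  | succ H ih =>
    simp only [firstError, he]
    by_cases hn : errorAbove M X t v = none
    · have h' : ∀ s ≤ H, (∀ i < s, errorAbove M X t ((rightNode X)^[i] (rightNode X v)) = none) →
          LocalIso X Y f (t + 5) ((rightNode X)^[s] (rightNode X v)) := by
        intro s hs hi
        refine h (s + 1) (by omega) fun i his => ?_
        cases i with
        | zero => exact hn
        | succ i => exact hi i (by omega)
      have hv' := h' 0 (Nat.zero_le _) (by simp)
      obtain ⟨h1, h2⟩ := ih h' hv' (hv'.of_succ.errorAbove_eq hf)
      rw [if_pos hn, if_pos hn, hv.rightNode_map hf, h1]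
      refine ⟨rfl, fun hnone s hs => ?_⟩
      cases s with
      | zero => rfl
      | succ s =>
        rw [Function.iterate_succ_apply, hv.rightNode_map hf,
          h2 (Option.map_eq_none_iff.1 hnone) s (by omega), Function.iterate_succ_apply]
    · rw [if_neg hn, if_neg hn]
      exact ⟨rfl, fun h => by simp at h⟩

open Classical in
/-- The output is determined by a neighbourhood that contains the nodes inspected by the rule. -/
theorem LocalIso.output_eq (hf : Function.Injective f) {t H L : ℕ} (hL : L ≤ H)
    {B : (ℕ → ℕ × Bool) → Γ} (hB : DependsOn B (Set.Iic L)) {v : V} (hv : LocalIso X Y f (t + 5) v)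
    (h : ¬ X.Has (.dir .D) v → ∀ s ≤ H,
      (∀ i < s, errorAbove M X t ((rightNode X)^[i] v) = none) →
      LocalIso X Y f (t + 5) ((rightNode X)^[s] v)) {ident : V → ℕ} {ident' : W → ℕ}
    (hid : ∀ u, ident' (f u) = ident u) :
    output M B t H Y ident' (f v) = output M B t H X ident v := by
  unfold output
  rw [(hv.mono (by omega)).errorAbove_eq hf, hv.has_iff]
  simp only [(hv.mono (by omega : 4 ≤ t + 5)).nearWitness_iff hf]
  split_ifs with hNW hD
  · rfl
  · rfl
  · obtain ⟨h1, h2⟩ := LocalIso.firstError_eq hf (h hD)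
    cases he : errorAbove M X t v with
    | some b => rfl
    | none =>
      dsimp only
      rw [h1]
      cases hfe : firstError M X t H v with
      | some s => rfl
      | none =>
        dsimp only
        congr 1
        refine hB fun s hs => ?_
        have hs' : s ≤ H := le_trans hs hL
        have hclean := firstError_eq_none hfe
        rw [h2 hfe s hs', hid, (h hD s hs' fun i hi => hclean i (by omega)).2.2.1]

/-! ### Neighbourhoods as labelled graphs -/

open Classical in
/-- The labelled graph on the identifiers that is described by a view. -/
def View.toGraph {Lab : Type} (w : View Lab) : LabelledGraph Lab ℕ where
  graph := SimpleGraph.fromRel w.adj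
  input a := decide (a ∈ w.ones)
  edgeLabels := w.edgeLabels

open Classical in
theorem localIso_view {Lab : Type} {X : LabelledGraph Lab V} (hconn : X.graph.Connected)
    {ident : V → ℕ} (hid : Function.Injective ident) {R : ℕ} {v : V} {n : ℕ} {u : V}
    (h : X.graph.dist v u + n ≤ R) : LocalIso X (X.view ident R v).toGraph ident n u := by
  induction n generalizing u with
  | zero => trivial
  | succ n ih =>
    have hu : X.graph.dist v u ≤ R := by omega
    have hdist : ∀ w, X.graph.Adj u w → X.graph.dist v w ≤ X.graph.dist v u + 1 := fun w hw => by
      rw [← SimpleGraph.dist_eq_one_iff_adj.2 hw]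
      exact hconn.dist_triangle
    have hball : ∀ w, X.graph.Adj u w → X.graph.dist v w ≤ R := fun w hw => by
      have := hdist w hw
      omega
    refine ⟨fun b => ?_, fun w hw => ?_, ?_, fun w hw => ih (by have := hdist w hw; omega)⟩
    · simp only [View.toGraph, LabelledGraph.view, SimpleGraph.fromRel_adj]
      constructor
      · rintro ⟨-, ⟨a, w, -, -, haw, ha, rfl⟩ | ⟨w, a, -, -, hwa, rfl, ha⟩⟩
        · exact ⟨w, rfl, hid ha ▸ haw⟩
        · exact ⟨w, rfl, hid ha ▸ hwa.symm⟩
      · rintro ⟨w, rfl, hw⟩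
        exact ⟨fun he => hw.ne (hid he), Or.inl ⟨u, w, hu, hball w hw, hw, rfl, rfl⟩⟩
    · ext l
      simp only [View.toGraph, LabelledGraph.view, Set.mem_ofPred_eq]
      constructor
      · rintro ⟨a, b, -, -, -, hl, ha, hb⟩
        rwa [hid ha, hid hb] at hl
      · exact fun hl => ⟨u, w, hu, hball w hw, hw, hl, rfl, rfl⟩
    · change decide (ident u ∈ (X.view ident R v).ones) = X.input u
      rw [Bool.eq_iff_iff, decide_eq_true_iff]
      constructor
      · rintro ⟨a, -, ha, hau⟩
        rwa [hid hau] at ha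
      · exact fun hin => ⟨u, hu, hin, rfl⟩

end Output

/-! ### Validity of the output -/

section Validity

variable {M : LinkMachine} {Γ V : Type} {X : LabelledGraph M.Labels V}
  {B : (ℕ → ℕ × Bool) → Γ} {t H : ℕ} {ident : V → ℕ} {v : V}

theorem output_of_nearWitness (h : NearWitness M X v) : output M B t H X ident v = .err := by
  simp [output, h]

theorem output_of_errorAbove (h : ¬ NearWitness M X v) {b : Bool}
    (hb : errorAbove M X t v = some b) : output M B t H X ident v = .ptr .up 0 b := by
  simp [output, h, hb]

theorem output_of_has_down (h : errorAbove M X t v = none) (hD : X.Has (.dir .D) v) :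
    output M B t H X ident v = .empty := by
  simp [output, not_nearWitness_of_errorAbove h, h, hD]

theorem output_of_firstError (h : errorAbove M X t v = none) (hD : ¬ X.Has (.dir .D) v) {s : ℕ}
    (hs : firstError M X t H v = some s) :
    output M B t H X ident v = .ptr .right s false := by
  simp [output, not_nearWitness_of_errorAbove h, h, hD, hs]

theorem output_of_no_error (h : errorAbove M X t v = none) (hD : ¬ X.Has (.dir .D) v)
    (hs : firstError M X t H v = none) :
    output M B t H X ident v =
      .sol (B fun s => (ident ((rightNode X)^[s] v), X.input ((rightNode X)^[s] v))) := by
  simp [output, not_nearWitness_of_errorAbove h, h, hD, hs]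

variable (M B t H X ident v) in
theorem output_cases :
    (NearWitness M X v ∧ output M B t H X ident v = .err) ∨
    (¬ NearWitness M X v ∧ ∃ b, errorAbove M X t v = some b ∧
      output M B t H X ident v = .ptr .up 0 b) ∨
    (¬ NearWitness M X v ∧ errorAbove M X t v = none ∧ X.Has (.dir .D) v ∧
      output M B t H X ident v = .empty) ∨
    (¬ NearWitness M X v ∧ errorAbove M X t v = none ∧ ¬ X.Has (.dir .D) v ∧
      ∃ s, firstError M X t H v = some s ∧ output M B t H X ident v = .ptr .right s false) ∨
    (¬ NearWitness M X v ∧ errorAbove M X t v = none ∧ ¬ X.Has (.dir .D) v ∧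
      firstError M X t H v = none ∧ output M B t H X ident v =
        .sol (B fun s => (ident ((rightNode X)^[s] v), X.input ((rightNode X)^[s] v)))) := by
  by_cases h : NearWitness M X v
  · exact Or.inl ⟨h, output_of_nearWitness h⟩
  cases hb : errorAbove M X t v with
  | some b => exact Or.inr (Or.inl ⟨h, b, rfl, output_of_errorAbove h hb⟩)
  | none =>
    by_cases hD : X.Has (.dir .D) v
    · exact Or.inr (Or.inr (Or.inl ⟨h, rfl, hD, output_of_has_down hb hD⟩))
    cases hs : firstError M X t H v with
    | some s =>
      exact Or.inr (Or.inr (Or.inr (Or.inl ⟨h, rfl, hD, s, rfl, output_of_firstError hb hD hs⟩)))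
    | none =>
      exact Or.inr (Or.inr (Or.inr (Or.inr ⟨h, rfl, hD, rfl, output_of_no_error hb hD hs⟩)))

theorem exists_of_errorAbove (h : ¬ NearWitness M X v) {b : Bool}
    (hb : errorAbove M X t v = some b) :
    ∃ u, nextDir X .U v = some u ∧ errorAbove M X t u = some b := by
  cases t with
  | zero => simp [errorAbove, h] at hb
  | succ t =>
    rw [errorAbove, if_neg h, Option.bind_eq_some_iff] at hb
    obtain ⟨u, hu, hb⟩ := hb
    exact ⟨u, hu, errorAbove_mono hb⟩

/-- The outputs are valid, provided that the rule `B` works on all parts of the bottom row without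
errors in sight. -/
theorem linkProblem_output (Q : CycleLCL Γ) (hid : Function.Injective ident)
    (hB : ∀ v, ¬ X.Has (.dir .D) v →
      (∀ s ≤ H, errorAbove M X t ((rightNode X)^[s] v) = none) →
      RuleOK Q B fun s => (ident ((rightNode X)^[s] v), X.input ((rightNode X)^[s] v))) :
    linkProblem M Q V X (output M B t H X ident) := by
  intro v
  have hcases := output_cases M X B t H ident v
  refine ⟨?_, fun y hy => ?_, fun w y hw0 hw hy => ?_, fun he => ?_, fun d q b hp => ?_⟩
  · rcases hcases with ⟨h, ho⟩ | ⟨h, b, -, ho⟩ | ⟨h, -, -, ho⟩ | ⟨h, -, -, s, -, ho⟩ |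
      ⟨h, -, -, -, ho⟩ <;> simp [ho, h]
  · rcases hcases with ⟨-, ho⟩ | ⟨-, b, -, ho⟩ | ⟨-, -, -, ho⟩ | ⟨-, -, -, s, -, ho⟩ |
      ⟨-, -, hD, -, -⟩
    · simp [ho] at hy
    · simp [ho] at hy
    · simp [ho] at hy
    · simp [ho] at hy
    · exact hD
  · have hsol : ∀ u z, output M B t H X ident u = .sol z →
        ¬ X.Has (.dir .D) u ∧ firstError M X t H u = none ∧
        z = B fun s => (ident ((rightNode X)^[s] u), X.input ((rightNode X)^[s] u)) := by
      intro u z hz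
      rcases output_cases M X B t H ident u with ⟨-, ho⟩ | ⟨-, b, -, ho⟩ | ⟨-, -, -, ho⟩ |
        ⟨-, -, -, s, -, ho⟩ | ⟨-, -, hD, hs, ho⟩
      · simp [ho] at hz
      · simp [ho] at hz
      · simp [ho] at hz
      · simp [ho] at hz
      · rw [ho, Out.sol.injEq] at hz
        exact ⟨hD, hs, hz.symm⟩
    have hwi : ∀ i, w i = (rightNode X)^[(i : ℕ)] v := by
      intro i
      induction i using Fin.induction with
      | zero => exact hw0
      | succ i ih =>
        rw [Fin.val_succ, Function.iterate_succ_apply', ← Fin.val_castSucc, ← ih, rightNode, hw i]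
        rfl
    obtain ⟨hD, hs, -⟩ := hsol v (y 0) (hw0 ▸ hy 0)
    refine CycleLCL.ok_congr (hB v hD (firstError_eq_none hs)) (fun i => ?_) fun i j => ?_
    · obtain ⟨-, -, hyi⟩ := hsol _ _ (hy i)
      rw [hyi, hwi i]
      refine Prod.ext rfl (congrArg B (funext fun l => ?_))
      rw [← Function.iterate_add_apply, add_comm l]
    · rw [hwi i, hwi j, hid.eq_iff]
  · rcases hcases with ⟨-, ho⟩ | ⟨-, b, -, ho⟩ | ⟨-, -, hD, -⟩ | ⟨-, -, -, s, -, ho⟩ |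
      ⟨-, -, -, -, ho⟩
    · simp [ho] at he
    · simp [ho] at he
    · exact hD
    · simp [ho] at he
    · simp [ho] at he
  · rcases hcases with ⟨-, ho⟩ | ⟨hNW, b', hb', ho⟩ | ⟨-, -, -, ho⟩ |
      ⟨hNW, hb', hD, s, hs, ho⟩ | ⟨-, -, -, -, ho⟩
    · simp [ho] at hp
    · -- a pointer up: the node above it outputs `E` or points up as well, to the same error
      rw [ho, Out.ptr.injEq] at hp
      obtain ⟨rfl, rfl, rfl⟩ := hp
      obtain ⟨u, hu, hbu⟩ := exists_of_errorAbove hNW hb'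
      refine ⟨fun _ => rfl, u, hu, ?_⟩
      by_cases hNWu : NearWitness M X u
      · have hou : output M B t H X ident u = .err := output_of_nearWitness hNWu
        rw [errorAbove_of_nearWitness hNWu, Option.some_inj] at hbu
        simp [hou, hbu]
      · have hou : output M B t H X ident u = .ptr .up 0 b' := output_of_errorAbove hNWu hbu
        simp [hou]
    · simp [ho] at hp
    · -- a pointer to the right: the distance to the column with the error decreases by one
      rw [ho, Out.ptr.injEq] at hp
      obtain ⟨rfl, rfl, rfl⟩ := hp
      have hloc := localOK_of_not_nearWitness hNW
      refine ⟨fun h => absurd h hD, rightNode X v, nextDir_right hloc, ?_⟩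
      obtain ⟨s', rfl, hs'⟩ := exists_of_firstError hb' hs
      by_cases hNWu : NearWitness M X (rightNode X v)
      · have hou : output M B t H X ident (rightNode X v) = .err := output_of_nearWitness hNWu
        simp [hou]
      cases hbu : errorAbove M X t (rightNode X v) with
      | some b =>
        have hou : output M B t H X ident (rightNode X v) = .ptr .up 0 b :=
          output_of_errorAbove hNWu hbu
        simp [hou]
      | none =>
        have hou : output M B t H X ident (rightNode X v) = .ptr .right s' false :=
          output_of_firstError hbu (not_has_down_rightNode hloc hD) hs'
        simp [hou]
    · simp [ho] at hp

end Validity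

/-! ### Running time -/

section RunningTime

variable {M : LinkMachine}

theorem le_speed (hk : 0 < M.numRegs) (i : ℕ) : i ≤ M.speed i :=
  Nat.le_mul_of_pos_right _ (LinkMachine.one_le_growth hk i)

theorem le_speed_genInv (hk : 0 < M.numRegs) (y : ℕ) : y ≤ M.speed (genInv M.speed y) :=
  Nat.sInf_mem (s := {m | y ≤ M.speed m}) ⟨y, le_speed hk y⟩

theorem genInv_le (hk : 0 < M.numRegs) (y : ℕ) : genInv M.speed y ≤ y :=
  Nat.sInf_le (le_speed hk y)

theorem speed_lt_of_lt_genInv {y i : ℕ} (hi : i < genInv M.speed y) : M.speed i < y := by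
  by_contra! h
  exact Nat.notMem_of_lt_sInf hi h

/-- If the top row is below height `f⁻¹(y)`, then correct parts of the grid that do not wrap around
have width `O(y)`. -/
theorem margin_add_growth_le (hmono : Monotone M.growth) (hk : 0 < M.numRegs) {y h : ℕ}
    (h1 : 1 ≤ h) (hh : h < genInv M.speed y) :
    M.margin (h + 1) + 2 * M.growth (h + 1) ≤ 4 * 2 ^ M.len * (y + 1) := by
  have hs := speed_lt_of_lt_genInv hh
  have h2 := LinkMachine.margin_succ_le hmono h
  have h3 := LinkMachine.growth_succ_le hk h
  have h4 : (h + 1) * M.growth h ≤ 2 * M.speed h := by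
    unfold LinkMachine.speed
    nlinarith [Nat.zero_le (M.growth h)]
  have h5 : M.growth h ≤ M.speed h := Nat.le_mul_of_pos_left _ h1
  have h6 : 2 ^ M.len * ((h + 1) * M.growth h) ≤ 2 ^ M.len * (2 * y) :=
    Nat.mul_le_mul_left _ (by omega)
  have h7 : 2 ^ M.len * M.growth h ≤ 2 ^ M.len * y := Nat.mul_le_mul_left _ (by omega)
  have h8 : 1 ≤ 2 ^ M.len := Nat.one_le_two_pow
  nlinarith

/-- In a row that does not close up within `L + 1` steps and with no errors in sight, the columns have
height `t`. Hence there are at least `(L + 1) t` nodes. -/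
theorem mul_le_card {V : Type} [Fintype V] {X : LabelledGraph M.Labels V}
    (hmono : Monotone M.growth) (hk : 0 < M.numRegs) {v : V} {y L : ℕ}
    (hL : 4 * 2 ^ M.len * (y + 1) ≤ L) (hD : ¬ X.Has (.dir .D) v)
    (hok : ∀ s < L + 1, errorAbove M X (genInv M.speed y) ((rightNode X)^[s] v) = none)
    (hinj : ∀ s < L + 1, ∀ s' < L + 1, (rightNode X)^[s] v = (rightNode X)^[s'] v → s = s') :
    (L + 1) * genInv M.speed y ≤ Fintype.card V := by
  obtain ⟨h, hht, hR, htop⟩ := exists_isRegion hD hok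
  rcases hht.lt_or_eq with hlt | rfl
  · exfalso
    have hh : 1 ≤ h := by
      by_contra! h0
      obtain rfl : h = 0 := by omega
      have hloc := localOK_of_not_nearWitness (not_nearWitness_of_errorAbove (hok 0 (by omega)))
      exact hloc.1.2.2.2.2.2.1.elim (htop hlt) hD
    have h1 := hR.width_le_of_top hinj hk (htop hlt)
    have h2 := margin_add_growth_le hmono hk hh hlt
    omega
  · let e : Fin (L + 1) × Fin (genInv M.speed y) → V :=
      fun a => (upNode X)^[(a.2 : ℕ)] ((rightNode X)^[(a.1 : ℕ)] v)
    have he : Function.Injective e := by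
      rintro ⟨s, i⟩ ⟨s', i'⟩ h
      obtain ⟨h1, h2⟩ := hR.eq_of_eq hinj s.2 s'.2 i.2.le i'.2.le h
      exact Prod.ext (Fin.ext h1) (Fin.ext h2)
    simpa using Fintype.card_le_of_injective e he

end RunningTime

end LinkLCL

end

open LinkLCL in
theorem mainTheorem4 (M : LinkLCL.LinkMachine)
    (hmono : Monotone M.growth)
    (hgrow : Filter.Tendsto M.growth Filter.atTop Filter.atTop)
    (hexp : ∃ C : ℕ, ∀ᶠ ℓ in Filter.atTop, M.growth ℓ ≤ 2 ^ (C * ℓ))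
    (Γ : Type) [Finite Γ] (Q : LinkLCL.CycleLCL Γ)
    (c : ℕ) (hc : 1 ≤ c)
    (T : ℕ → ℕ) (hT : Q.HasComplexity c T)
    (nhat : ℕ → ℕ)
    (hnhat : ∀ n : ℕ, 1 ≤ n →
      IsLeast {m : ℕ | n ≤ m * LinkLCL.genInv M.speed (T m)} (nhat n))
    (Δ : ℕ) :
    ∃ C : ℕ, (LinkLCL.linkProblem M Q).SolvableInTime Δ c
      (fun n => C * LinkLCL.genInv M.speed (T (nhat n))) := by
  have hk : 0 < M.numRegs := by
    by_contra! hk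
    have hemp : IsEmpty (Fin M.numRegs) := ⟨fun r => absurd r.2 (by omega)⟩
    obtain ⟨ℓ, hℓ⟩ := (hgrow.eventually_ge_atTop 1).exists
    have : M.growth ℓ = 0 := by
      unfold LinkMachine.growth
      rw [Finset.univ_eq_empty, Finset.sup_empty]
      rfl
    omega
  obtain ⟨K, hK⟩ := hT.exists_row_rule hc
  set K' := K + 4 * 2 ^ M.len + 1 with hK'
  choose B hBdep hBcyc hBpath using
    fun m => hK m (K' * (T m + 1)) (Nat.mul_le_mul_right _ (by omega))
  set D := K' + Q.width with hDdef
  refine ⟨2 * D + 4 * 2 ^ M.len + 9, fun n w => output M (B (nhat n))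
    (genInv M.speed (T (nhat n))) (K' * (T (nhat n) + 1) + Q.width) w.toGraph id w.center, ?_⟩
  intro V _ X ident hconn _ hid
  set n := Fintype.card V with hn
  have hn1 : 1 ≤ n := by
    have := hconn.nonempty
    exact Fintype.card_pos
  have hnm : n ≤ nhat n * genInv M.speed (T (nhat n)) := (hnhat n hn1).1
  set m := nhat n
  set t := genInv M.speed (T m) with ht
  set L := K' * (T m + 1) with hL
  have ht1 : 1 ≤ t := by
    by_contra! h0
    rw [show t = 0 by omega] at hnm
    omega
  have htT : t ≤ T m := genInv_le hk _
  have hTt : T m ≤ M.speed t := le_speed_genInv hk _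
  have hHD : L + Q.width ≤ D * (M.speed t + 1) := by
    rw [hDdef, add_mul]
    exact Nat.add_le_add (Nat.mul_le_mul_left _ (by omega)) (Nat.le_mul_of_pos_right _ (by omega))
  have hL4 : 4 * 2 ^ M.len * (T m + 1) ≤ L := Nat.mul_le_mul_right _ (by omega)
  have hTL : T m ≤ L := by
    have : 1 * (T m + 1) ≤ L := Nat.mul_le_mul_right _ (by omega)
    omega
  -- the algorithm computes the outputs from the views
  have hloc : ∀ v, output M (B m) t (L + Q.width)
      (X.view ident ((2 * D + 4 * 2 ^ M.len + 9) * t) v).toGraph id (ident v) =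
      output M (B m) t (L + Q.width) X ident v := by
    intro v
    have hexpand : (2 * D + 4 * 2 ^ M.len + 9) * t =
        (2 * D + 4 * 2 ^ M.len + 3) * t + 6 * t := by ring
    refine LocalIso.output_eq hid.1 (Nat.le_add_right _ _) (hBdep m) ?_ (fun hDv s hs hs' => ?_)
      (fun u => rfl)
    · refine localIso_view hconn hid.1 ?_
      rw [SimpleGraph.dist_self]
      omega
    · refine localIso_view hconn hid.1 ?_
      have := dist_iterate_rightNode_le hconn hk ht1 (hs.trans hHD) hDv hs'
      omega
  change linkProblem M Q V X (fun v => output M (B m) t (L + Q.width)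
      (X.view ident ((2 * D + 4 * 2 ^ M.len + 9) * t) v).toGraph id (ident v))
  rw [funext hloc]
  refine linkProblem_output Q hid.1 fun v hDv hclean => ?_
  have hNW : ∀ s < L + Q.width + 1, ¬ NearWitness M X ((rightNode X)^[s] v) :=
    fun s hs => not_nearWitness_of_errorAbove (hclean s (by omega))
  by_cases hwrap : ∃ w, (1 ≤ w ∧ w ≤ L) ∧ (rightNode X)^[w] v = v
  · -- the row closes up within sight
    classical
    obtain ⟨⟨hw1, hwL⟩, hw⟩ := Nat.find_spec hwrap
    have hmin := fun w => Nat.find_min hwrap (m := w)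
    set w := Nat.find hwrap
    refine hBcyc m _ w (three_le_of_iterate_eq (hNW 0 (by omega)) hw1 hw) hwL ?_ ?_
    · intro i
      simp only [Function.iterate_add_apply, hw]
    · have aux : ∀ i i', i < i' → i' < w →
          (rightNode X)^[i] v ≠ (rightNode X)^[i'] v := by
        intro i i' hlt hi' he
        refine hmin (i' - i) (by omega) ⟨by omega, iterate_eq_self (i := i) hNW (by omega)
          (by omega) ?_⟩
        rw [Nat.add_sub_cancel' hlt.le, he]
      intro i hi i' hi' he
      have he' := hid.1 he
      rcases lt_trichotomy i i' with hlt | heq | hlt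
      · exact absurd he' (aux i i' hlt hi')
      · exact heq
      · exact absurd he'.symm (aux i' i hlt hi)
  · have hne : ∀ i w, 1 ≤ w → w ≤ L → i + w ≤ L + Q.width →
        (rightNode X)^[i + w] v ≠ (rightNode X)^[i] v := fun i w h1 h2 h3 he =>
      hwrap ⟨w, ⟨h1, h2⟩, iterate_eq_self hNW (by omega) h1 he⟩
    have hinj : ∀ s < L + 1, ∀ s' < L + 1,
        (rightNode X)^[s] v = (rightNode X)^[s'] v → s = s' := by
      intro s hs s' hs' he
      rcases lt_trichotomy s s' with hlt | heq | hlt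
      · have := hne s (s' - s) (by omega) (by omega) (by omega)
        rw [Nat.add_sub_cancel' hlt.le] at this
        exact absurd he.symm this
      · exact heq
      · have := hne s' (s - s') (by omega) (by omega) (by omega)
        rw [Nat.add_sub_cancel' hlt.le] at this
        exact absurd he this
    have hcard := mul_le_card hmono hk hL4 hDv (fun s hs => hclean s (by omega)) hinj
    have hLm : L < m := by
      have : (L + 1) * t ≤ m * t := hcard.trans hnm
      exact Nat.le_of_mul_le_mul_right this ht1
    refine hBpath m _ hLm (fun i _ => ?_) (fun i w h1 h2 h3 he => hne i w h1 h2 h3 (hid.1 he))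
    refine (hid.2 _).2.trans ?_
    rw [pow_mul]
    refine Nat.pow_le_pow_left (hnm.trans ?_) c
    rw [pow_two]
    exact Nat.mul_le_mul_left _ (by omega)
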